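/- **Setting.** Constants are objects, values or tuple identifiers (tids), three disjoint sorts. A schema is a finite set of relation symbols $R$, each with an arity $k$ and a type (object or value) for each position $1,\dots,k$. A database $D$ is a finite set of well-typed facts $R(t,c_1,\dots,c_k)$ with $t$ a tid (position $0$), each tid occurring in at most one fact; $t[i]$ is the constant at position $i$ of the fact with tid $t$. $\mathrm{Dom}(D)$ is the set of constants (tids included), $\mathrm{Obj}(D)$ the set of objects, occurring in $D$, and $\mathrm{Cells}(D)$ the set of pairs $\langle t,i\rangle$ such that $t$ is the tid of a fact of $D$ and $i$ a value position of its relation. For equivalence relations $E$ on $\mathrm{Obj}(D)$ and $V$ on $\mathrm{Cells}(D)$, the induced database $D_{E,V}$ is obtained from $D$ by replacing each tid $t$ by $\{t\}$, each object $o$ by $\{o' : (o,o')\in E\}$, and the value in each cell $\langle t,i\rangle$ by $\{t'[i'] : (\langle t,i\rangle,\langle t',i'\rangle)\in V\}$. A query is a finite conjunction of relational atoms $R(u_0,\dots,u_k)$, similarity atoms $u\approx w$ and inequality atoms $u\neq w$ (terms are variables or constants; there may be several predicates $\approx$, each a fixed binary relation on values; variables of similarity atoms occur in value positions, variables of inequality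 atoms in relational atoms). A Boolean query $q$ holds in $D_{E,V}$ if one can choose for each relational atom $\pi=R(u_0,\dots,u_k)$ sets $g_\pi(0),\dots,g_\pi(k)$ with $R(g_\pi(0),\dots,g_\pi(k))\in D_{E,V}$ such that, with $h(a)=\{a\}$ for constants and $h(z)=\bigcap\{g_\pi(i) : z \text{ is at position } i \text{ of } \pi\}$ for variables: every $h(u)$ is a nonempty subset of $\mathrm{Dom}(D)$; a constant at position $i$ of $\pi$ belongs to $g_\pi(i)$; $h(u)\cap h(w)=\emptyset$ for each atom $u\neq w$; and for each atom $u\approx w$ there are $c\in h(u)$, $d\in h(w)$ with $c\approx d$. The answers $q(D_{E,V})$ to $q(x,y)$ are the pairs $(c,d)$ such that $q[c,d]$ holds. A specification $\Sigma$ consists of finite sets of: hard and soft rules for objects $q(x,y)\to \mathsf{EqO}(x,y)$, where $x,y$ occur in $q$ and only in object positions; hard and soft rules for values $q(x_t,y_t)\to\mathsf{EqV}(\langle x_t,i\rangle,\langle y_t,j\rangle)$, where $x_t,y_t$ each occur once in $q$, in position $0$ of atoms whose relations have $i$, resp. $j$, as a value position; and denial constraints $\varphi\to\bot$. Rule bodies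 have no inequality atoms, denial constraints no similarity atoms. Candidate solutions $\langle E,V\rangle$ are generated from the two identity relations (on $\mathrm{Obj}(D)$ and $\mathrm{Cells}(D)$) by repeatedly adding to $E$ a pair $(o,o')\in q(D_{E,V})$ for some rule for objects, or to $V$ a pair $(\langle t,i\rangle,\langle t',j\rangle)$ with $(t,t')\in q(D_{E,V})$ for some rule for values, and closing to an equivalence relation. A candidate solution is a *solution* for $(D,\Sigma)$ if moreover $q(D_{E,V})\subseteq E$ for every hard rule for objects, $(t,t')\in q(D_{E,V})$ implies $(\langle t,i\rangle,\langle t',j\rangle)\in V$ for every hard rule for values, and no body of a denial constraint holds in $D_{E,V}$. **The program.** $\Pi_{Sol}$ is the following (finite) normal logic program, which depends only on the schema and on $\Sigma$. For a query $q$ let $\mathrm{rel}(q)$ be its relational atoms with the term at each position $i\ge 1$ of each atom $\pi$ replaced by a fresh variable $w_{\pi,i}$ (the tid term $u_\pi$ is kept). For a term $c$, let $\mathrm{In}_{\pi,i}(c)$ be $\mathit{Val}(u_\pi,i,c)$ if $i$ is a value position, $\mathit{EqO}(w_{\pi,i},c)$ if it is an object position, and $\mathit{Same}(c,u_\pi)$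 if $i=0$. Let $\mathrm{join}(q)$ consist of $\mathrm{In}_{\pi,i}(a)$ for each constant $a$ at a position $i\geq 1$ of an atom $\pi$ of $q$, and $\mathrm{In}_{\pi,i}(v)$ for each occurrence at a position $i\ge1$ of a variable $v$ occurring at least twice in relational atoms. Let $\mathrm{sim}(q)$ consist, for each atom $v\approx w$ of $q$, of $v'\approx w'$ with new variables $v',w'$ together with $\mathit{Val}(u_\pi,i,v')$ for all occurrences of $v$ in value positions and $\mathit{Val}(u_\pi,i,w')$ for those of $w$ (a constant is left in place). Let $\hat q=\mathrm{rel}(q)\cup\mathrm{join}(q)\cup\mathrm{sim}(q)$. The rules are: 1. for each $R/k$: $\mathit{Tid}(u)\leftarrow R(u,\bar v)$; $\mathit{Proj}(u,i,v_i)\leftarrow R(u,\bar v)$ for all $1\le i\le k$; $\mathit{Obj}(v_i)\leftarrow R(u,\bar v)$ for the object positions $i$, and $\mathit{Valpos}(u,i)\leftarrow R(u,\bar v)$ for the value positions $i$; and $\mathit{Val}(u,i,v)\leftarrow \mathit{EqV}(u,i,u',j),\mathit{Proj}(u',j,v)$; $\mathit{Same}(c,c)\leftarrow\mathit{Tid}(c)$;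 $\mathit{Same}(c,c)\leftarrow\mathit{Proj}(u,i,c)$; 2. rules making $\mathit{EqO}$ and $\mathit{EqV}$ reflexive (on $\mathit{Obj}$, resp. on the pairs $u,i$ with $\mathit{Tid}(u),\mathit{Valpos}(u,i)$), symmetric and transitive; 3. for each hard (soft) rule for objects, $\mathit{EqO}(x',y')\leftarrow\hat q$ (resp. $\mathit{ActiveO}(x',y')\leftarrow\hat q$), where $x',y'$ are the fresh variables at the first occurrences of $x$ and $y$; for each hard (soft) rule for values, $\mathit{EqV}(x_t,i,y_t,j)\leftarrow\hat q$ (resp. $\mathit{ActiveV}(x_t,i,y_t,j)\leftarrow\hat q$); 4. $\mathit{EqO}(x,y)\leftarrow\mathit{ActiveO}(x,y),\mathit{not}\ \mathit{NEqO}(x,y)$; $\mathit{NEqO}(x,y)\leftarrow\mathit{ActiveO}(x,y),\mathit{not}\ \mathit{EqO}(x,y)$; and the same two rules for $\mathit{EqV},\mathit{ActiveV},\mathit{NEqV}$ (of arity 4); 5. for each denial constraint $\varphi\to\bot$ with relational atoms $\pi_1,\dots,\pi_n$ and inequality atoms $z_1\ne z_1',\dots,z_m\neq z'_m$: the constraint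 $\leftarrow \mathrm{rel}(\varphi),\mathrm{join}(\varphi),\mathit{Same}(a,a)\,(a\text{ a constant in an inequality atom}),\mathit{not}\ \mathit{Common}_{\varphi,1}(u_{\pi_1},\dots,u_{\pi_n}),\dots,\mathit{not}\ \mathit{Common}_{\varphi,m}(u_{\pi_1},\dots,u_{\pi_n})$, and for each $j$ the rule $\mathit{Common}_{\varphi,j}(u_{\pi_1},\dots,u_{\pi_n})\leftarrow\mathrm{rel}(\varphi),\mathrm{In}(c)$, where $\mathrm{In}(c)$ consists of $\mathrm{In}_{\pi,i}(c)$ for all occurrences of $z_j$ and of $z'_j$ in relational atoms of $\varphi$ (of $\mathit{Same}(c,a)$ for a side that is a constant $a$), with $c$ a fresh variable. The program is evaluated together with the facts of $D$ and the facts $c\approx d$ for the pairs of similar values $c,d\in\mathrm{Dom}(D)$; a stable model of $(\Pi_{Sol},D)$ is a set $M$ of ground atoms that is a minimal model of these facts and of the reduct, relative to $M$, of the grounding of $\Pi_{Sol}$. **Theorem.** For every specification $\Sigma$, every database $D$ over the same schema, and all $E,V$: $\langle E,V\rangle$ is a solution for $(D,\Sigma)$ if and only if there is a stable model $M$ of $(\Pi_{Sol},D)$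 with $$E=\{(a,b) : \mathit{EqO}(a,b)\in M\}\quad\text{and}\quad V=\{(\langle t,i\rangle,\langle t',i'\rangle) : \mathit{EqV}(t,i,t',i')\in M\}.$$ -/

import Mathlib

namespace Lace

universe u v

/-! ## Normal logic programs and stable models -/

/-- Terms: variables from `X` and constants from `K`. -/
inductive Term (X : Type u) (K : Type v) where
  | var (x : X)
  | cst (c : K)

/-- The value of a term under a substitution of the variables by constants. -/
def Term.ground {X K : Type*} (σ : X → K) : Term X K → K
  | .var x => σ x
  | .cst c => c

/-- `P(t₁, …, tₙ)`; ground atoms are the atoms whose arguments are constants. -/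
structure Atom (P : Type u) (A : Type v) where
  pred : P
  args : List A

/-- The ground instance of an atom under a substitution. -/
def Atom.ground {P X K : Type*} (σ : X → K) (a : Atom P (Term X K)) : Atom P K :=
  ⟨a.pred, a.args.map (Term.ground σ)⟩

/-- A rule `head ← pos, not neg` of a normal logic program; the head `none` is that of a constraint
`← pos, not neg`. -/
structure Rule (P X K : Type*) where
  head : Option (Atom P (Term X K))
  pos : List (Atom P (Term X K))
  neg : List (Atom P (Term X K)) := []

/-- `N` is a model of the reduct, relative to `M`, of the grounding of the program `Π` together
with the set of facts `F`. Constants of `K` interpret the variables in all possible ways. -/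
def IsModelOfReduct {P X K : Type*} (Pi : List (Rule P X K)) (F M N : Set (Atom P K)) : Prop :=
  F ⊆ N ∧ ∀ r ∈ Pi, ∀ σ : X → K, (∀ b ∈ r.neg, b.ground σ ∉ M) →
    (∀ b ∈ r.pos, b.ground σ ∈ N) → ∃ h, r.head = some h ∧ h.ground σ ∈ N

/-- `M` is a stable model of `(Π, F)`: it is a minimal model of the reduct relative to `M`. -/
def IsStableModel {P X K : Type*} (Pi : List (Rule P X K)) (F M : Set (Atom P K)) : Prop :=
  IsModelOfReduct Pi F M M ∧ ∀ N ⊆ M, IsModelOfReduct Pi F M N → N = M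

/-! ## Schemas and databases -/

/-- The two types of positions: object positions and value positions. -/
inductive Srt where
  | obj
  | val

/-- Constants: objects, values and tuple identifiers, three disjoint sets. -/
inductive Const (O V T : Type*) where
  | obj (o : O)
  | val (v : V)
  | tid (t : T)

/-- The constant belongs to the given type (object or value). -/
def Const.HasSrt {O V T : Type*} : Const O V T → Srt → Prop
  | .obj _, .obj => True
  | .val _, .val => True
  | _, _ => False

/-- A schema with the relation symbols `R`: the type vector of each symbol, whose length is the
arity. -/
structure Schema (R : Type u) where
  ty : R → List Srt

/-- Position `i` (counted from 1) of the relation symbol `r` has type `s`. -/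
def Schema.HasTy {R : Type*} (S : Schema R) (r : R) (i : ℕ) (s : Srt) : Prop :=
  ∃ j, i = j + 1 ∧ (S.ty r)[j]? = some s

/-- A fact `rel(tid, args)`. -/
structure Fact (R O V T : Type*) where
  rel : R
  tid : T
  args : List (Const O V T)

/-- A tid-annotated database: a finite set of well-typed facts, each tid in at most one fact. -/
structure Database {R : Type*} (S : Schema R) (O V T : Type*) where
  facts : Set (Fact R O V T)
  finite : facts.Finite
  typed : ∀ f ∈ facts, List.Forall₂ Const.HasSrt f.args (S.ty f.rel)
  tid_unique : ∀ f ∈ facts, ∀ g ∈ facts, f.tid = g.tid → f = g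

/-- A cell `⟨t, i⟩`, with positions counted from 1. -/
abbrev Cell (T : Type*) := T × ℕ

namespace Database

variable {R O V T : Type*} {S : Schema R} (D : Database S O V T)

/-- The constants (tids included) occurring in the database. -/
def dom : Set (Const O V T) := {c | ∃ f ∈ D.facts, c = .tid f.tid ∨ c ∈ f.args}

/-- The objects occurring in the database. -/
def objs : Set (Const O V T) := {c | ∃ o, c = .obj o ∧ c ∈ D.dom}

/-- The value cells of the database. -/
def cells : Set (Cell T) := {p | ∃ f ∈ D.facts, p.1 = f.tid ∧ S.HasTy f.rel p.2 .val}

/-- `t[i] = c`. -/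
def EntryIs (p : Cell T) (c : Const O V T) : Prop :=
  ∃ f ∈ D.facts, p.1 = f.tid ∧ ∃ j, p.2 = j + 1 ∧ f.args[j]? = some c

/-- The sets of constants that stand in the positions `0, 1, …, k` of the fact `f` in the database
induced by `E` and `W` (and `∅` beyond position `k`). -/
def extArgs (E : Set (Const O V T × Const O V T)) (W : Set (Cell T × Cell T))
    (f : Fact R O V T) : ℕ → Set (Const O V T)
  | 0 => {.tid f.tid}
  | j + 1 =>
    match f.args[j]? with
    | some (.obj o) => {c | (.obj o, c) ∈ E}
    | some (.val _) => {c | ∃ p, ((f.tid, j + 1), p) ∈ W ∧ D.EntryIs p c}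
    | _ => ∅

/-- The extended database induced by `D`, `E` and `W`. -/
def induced (E : Set (Const O V T × Const O V T)) (W : Set (Cell T × Cell T)) :
    Set (R × (ℕ → Set (Const O V T))) :=
  {p | ∃ f ∈ D.facts, p = (f.rel, D.extArgs E W f)}

end Database

/-! ## Queries -/

/-- A relational atom `rel(tid, args)`. -/
structure RelAtom (R C : Type*) where
  rel : R
  tid : Term ℕ C
  args : List (Term ℕ C)

/-- The body of a conjunctive query: relational atoms, similarity atoms (a similarity predicate
and two terms) and inequality atoms. -/
structure Query (R Q C : Type*) where
  rels : List (RelAtom R C)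
  sims : List (Q × Term ℕ C × Term ℕ C)
  neqs : List (Term ℕ C × Term ℕ C)

/-- An occurrence of a term in a query: position `i` of the relational atom `atom`, which is the
`k`-th one of the query. Position `0` is the tid position. -/
structure Occ (R C : Type*) where
  k : ℕ
  i : ℕ
  atom : RelAtom R C
  term : Term ℕ C

namespace Query

variable {R Q C : Type*}

/-- All occurrences of terms in the relational atoms of a query. -/
def occs (q : Query R Q C) : List (Occ R C) :=
  q.rels.zipIdx.flatMap fun (a, k) =>
    (a.tid :: a.args).zipIdx.map fun (u, i) => ⟨k, i, a, u⟩

/-- The terms (variables and constants) of a query. -/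
def terms (q : Query R Q C) : Set (Term ℕ C) :=
  {u | (∃ o ∈ q.occs, o.term = u) ∨ (∃ s ∈ q.sims, s.2.1 = u ∨ s.2.2 = u) ∨
    ∃ s ∈ q.neqs, s.1 = u ∨ s.2 = u}

/-- The variable occurs in some relational atom. -/
def OccursRel (q : Query R Q C) (x : ℕ) : Prop := ∃ o ∈ q.occs, o.term = .var x

/-- The variable occurs in some similarity or inequality atom. -/
def OccursBuiltin (q : Query R Q C) (x : ℕ) : Prop :=
  (∃ s ∈ q.sims, s.2.1 = .var x ∨ s.2.2 = .var x) ∨ ∃ s ∈ q.neqs, s.1 = .var x ∨ s.2 = .var x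

/-- Arities are respected, each variable of a similarity atom occurs in a value position, and each
variable of an inequality atom occurs in a relational atom. -/
structure WF (S : Schema R) (q : Query R Q C) : Prop where
  arity : ∀ a ∈ q.rels, a.args.length = (S.ty a.rel).length
  sim_safe : ∀ s ∈ q.sims, ∀ x, (s.2.1 = .var x ∨ s.2.2 = .var x) →
    ∃ o ∈ q.occs, o.term = .var x ∧ S.HasTy o.atom.rel o.i .val
  neq_safe : ∀ s ∈ q.neqs, ∀ x, (s.1 = .var x ∨ s.2 = .var x) → q.OccursRel x

/-- The term obtained from a term by replacing the variables `x` and `y` by constants. -/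
def instTerm (x y : ℕ) (c d : C) : Term ℕ C → Term ℕ C
  | .var z => if z = x then .cst c else if z = y then .cst d else .var z
  | .cst a => .cst a

/-- The query `q[c, d]`, in which the variables `x` and `y` are replaced by constants. -/
def inst (q : Query R Q C) (x y : ℕ) (c d : C) : Query R Q C where
  rels := q.rels.map fun a =>
    ⟨a.rel, instTerm x y c d a.tid, a.args.map (instTerm x y c d)⟩
  sims := q.sims.map fun s => (s.1, instTerm x y c d s.2.1, instTerm x y c d s.2.2)
  neqs := q.neqs.map fun s => (instTerm x y c d s.1, instTerm x y c d s.2)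

/-- The set assigned to a term, when `g k i` is the set assigned to position `i` of the `k`-th
relational atom and `B` is the set of available constants. -/
def termSet (q : Query R Q C) (B : Set C) (g : ℕ → ℕ → Set C) : Term ℕ C → Set C
  | .cst a => {a}
  | .var z => {c | c ∈ B ∧ ∀ o ∈ q.occs, o.term = .var z → c ∈ g o.k o.i}

end Query

section Semantics

variable {R Q O V T : Type*} {S : Schema R}

/-- The similarity of two constants: similarity predicates compare values only. -/
def SimConst (sim : Q → V → V → Prop) (p : Q) (c d : Const O V T) : Prop :=
  ∃ a b, c = .val a ∧ d = .val b ∧ sim p a b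

/-- The Boolean query `q` is satisfied in the database induced by `D`, `E` and `W`. -/
def Sat (sim : Q → V → V → Prop) (D : Database S O V T)
    (E : Set (Const O V T × Const O V T)) (W : Set (Cell T × Cell T))
    (q : Query R Q (Const O V T)) : Prop :=
  ∃ g : ℕ → ℕ → Set (Const O V T),
    (∀ u ∈ q.terms, (q.termSet D.dom g u).Nonempty ∧ q.termSet D.dom g u ⊆ D.dom) ∧
    (∀ k a, q.rels[k]? = some a → (a.rel, g k) ∈ D.induced E W) ∧
    (∀ o ∈ q.occs, ∀ a, o.term = .cst a → a ∈ g o.k o.i) ∧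
    (∀ s ∈ q.neqs, q.termSet D.dom g s.1 ∩ q.termSet D.dom g s.2 = ∅) ∧
    (∀ s ∈ q.sims, ∃ c ∈ q.termSet D.dom g s.2.1, ∃ d ∈ q.termSet D.dom g s.2.2,
      SimConst sim s.1 c d)

/-- The answers in the induced database to `q` with the free variables `x` and `y`. -/
def answers (sim : Q → V → V → Prop) (D : Database S O V T)
    (E : Set (Const O V T × Const O V T)) (W : Set (Cell T × Cell T))
    (q : Query R Q (Const O V T)) (x y : ℕ) : Set (Const O V T × Const O V T) :=
  {p | (x = y → p.1 = p.2) ∧ Sat sim D E W (q.inst x y p.1 p.2)}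

/-! ## Specifications and solutions -/

/-- `x` occurs in the query, and only in object positions. -/
def IsObjVar (S : Schema R) {C : Type*} (q : Query R Q C) (x : ℕ) : Prop :=
  q.OccursRel x ∧ (∀ o ∈ q.occs, o.term = .var x → S.HasTy o.atom.rel o.i .obj) ∧
    ¬ q.OccursBuiltin x

/-- `x` occurs exactly once in the query, in position `0` of a relational atom whose relation has
the value position `i`. -/
def IsTidVar (S : Schema R) {C : Type*} (q : Query R Q C) (x i : ℕ) : Prop :=
  (∃ k a, q.rels[k]? = some a ∧ a.tid = .var x ∧ S.HasTy a.rel i .val ∧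
    ∀ o ∈ q.occs, o.term = .var x → o.k = k ∧ o.i = 0) ∧ ¬ q.OccursBuiltin x

/-- The data of a rule for objects, `q(x, y) → EqO(x, y)`. -/
structure ObjRule (S : Schema R) (Q O V T : Type*) where
  q : Query R Q (Const O V T)
  x : ℕ
  y : ℕ
  wf : q.WF S
  no_neq : q.neqs = []
  hx : IsObjVar S q x
  hy : IsObjVar S q y

/-- The data of a rule for values, `q(x, y) → EqV(⟨x, i⟩, ⟨y, j⟩)`. -/
structure ValRule (S : Schema R) (Q O V T : Type*) where
  q : Query R Q (Const O V T)
  x : ℕ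
  y : ℕ
  i : ℕ
  j : ℕ
  wf : q.WF S
  no_neq : q.neqs = []
  hx : IsTidVar S q x i
  hy : IsTidVar S q y j

/-- A denial constraint `q → ⊥`, with relational and inequality atoms. -/
structure Denial (S : Schema R) (Q O V T : Type*) where
  q : Query R Q (Const O V T)
  wf : q.WF S
  no_sim : q.sims = []

/-- An entity resolution specification: hard and soft rules for objects, hard and soft rules for
values, and denial constraints. -/
structure Spec (S : Schema R) (Q O V T : Type*) where
  hardO : Finset (ObjRule S Q O V T)
  softO : Finset (ObjRule S Q O V T)
  hardV : Finset (ValRule S Q O V T)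
  softV : Finset (ValRule S Q O V T)
  denials : Finset (Denial S Q O V T)

/-- The least relation that contains `P`, is reflexive on `A`, symmetric and transitive. -/
inductive EqGen {α : Type*} (P : Set (α × α)) (A : Set α) : α → α → Prop
  | base {a b : α} : (a, b) ∈ P → EqGen P A a b
  | refl {a : α} : a ∈ A → EqGen P A a a
  | symm {a b : α} : EqGen P A a b → EqGen P A b a
  | trans {a b c : α} : EqGen P A a b → EqGen P A b c → EqGen P A a c

/-- The least equivalence relation on `A` that extends `P` (for `P ⊆ A × A`). -/
def eqRel {α : Type*} (P : Set (α × α)) (A : Set α) : Set (α × α) := {p | EqGen P A p.1 p.2}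

/-- `⟨E, W⟩` is a candidate solution. -/
inductive IsCandidate (sim : Q → V → V → Prop) (D : Database S O V T) (Sp : Spec S Q O V T) :
    Set (Const O V T × Const O V T) → Set (Cell T × Cell T) → Prop
  | init : IsCandidate sim D Sp (eqRel ∅ D.objs) (eqRel ∅ D.cells)
  | mergeO {E : Set (Const O V T × Const O V T)} {W : Set (Cell T × Cell T)}
      (r : ObjRule S Q O V T) (o o' : Const O V T) :
      IsCandidate sim D Sp E W → r ∈ Sp.hardO ∨ r ∈ Sp.softO →
      (o, o') ∈ answers sim D E W r.q r.x r.y →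
      IsCandidate sim D Sp (eqRel (E ∪ {(o, o')}) D.objs) W
  | mergeV {E : Set (Const O V T × Const O V T)} {W : Set (Cell T × Cell T)}
      (r : ValRule S Q O V T) (t t' : T) :
      IsCandidate sim D Sp E W → r ∈ Sp.hardV ∨ r ∈ Sp.softV →
      (.tid t, .tid t') ∈ answers sim D E W r.q r.x r.y →
      IsCandidate sim D Sp E (eqRel (W ∪ {((t, r.i), (t', r.j))}) D.cells)

/-- `⟨E, W⟩` is a solution: a candidate solution whose induced database satisfies the hard rules
and the denial constraints. -/
structure IsSolution (sim : Q → V → V → Prop) (D : Database S O V T) (Sp : Spec S Q O V T)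
    (E : Set (Const O V T × Const O V T)) (W : Set (Cell T × Cell T)) : Prop where
  candidate : IsCandidate sim D Sp E W
  hardO : ∀ r ∈ Sp.hardO, answers sim D E W r.q r.x r.y ⊆ E
  hardV : ∀ r ∈ Sp.hardV, ∀ t t' : T, (.tid t, .tid t') ∈ answers sim D E W r.q r.x r.y →
    ((t, r.i), (t', r.j)) ∈ W
  denials : ∀ d ∈ Sp.denials, ¬ Sat sim D E W d.q

end Semantics

/-! ## The logic program of a specification -/

/-- The predicates of the program: the relation symbols, the similarity predicates, and the
auxiliary predicates. `same` is equality on the constants of the database, and `common q j`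
concerns the `j`-th inequality atom of the denial constraint `q → ⊥`. -/
inductive Pred (R Q C : Type*) where
  | rel (r : R)
  | sim (p : Q)
  | proj
  | obj
  | tid
  | valpos
  | val
  | eqO
  | eqV
  | activeO
  | activeV
  | neqO
  | neqV
  | same
  | common (q : Query R Q C) (j : ℕ)

/-- Variables of the program: `orig x` for a variable `x` of a query, `occ k i` for the fresh
variable at position `i` of the `k`-th relational atom, `witL s` and `witR s` for the two fresh
variables of the `s`-th similarity atom, and further ones. -/
inductive PVar where
  | orig (x : ℕ)
  | occ (k i : ℕ)
  | witL (s : ℕ)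
  | witR (s : ℕ)
  | aux (n : ℕ)

section Program

variable {R Q O V T : Type*}

/-- The ground terms of the program: the constants and the numbers of positions. -/
abbrev GTerm (O V T : Type*) := Const O V T ⊕ ℕ

/-- Terms of the program. -/
abbrev PTerm (O V T : Type*) := Term PVar (GTerm O V T)

/-- Predicates of the program. -/
abbrev PPred (R Q O V T : Type*) := Pred R Q (Const O V T)

/-- Atoms of the program. -/
abbrev PAtom (R Q O V T : Type*) := Atom (PPred R Q O V T) (PTerm O V T)

/-- Ground atoms of the program. -/
abbrev GAtom (R Q O V T : Type*) := Atom (PPred R Q O V T) (GTerm O V T)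

/-- Rules of the program. -/
abbrev PRule (R Q O V T : Type*) := Rule (PPred R Q O V T) PVar (GTerm O V T)

/-- A position number as a term of the program. -/
def numT (i : ℕ) : PTerm O V T := .cst (.inr i)

/-- An auxiliary variable as a term of the program. -/
def auxT (n : ℕ) : PTerm O V T := .var (.aux n)

/-- A term of a query as a term of the program. -/
def ofTerm : Term ℕ (Const O V T) → PTerm O V T
  | .var x => .var (.orig x)
  | .cst c => .cst (.inl c)

/-- The term is the variable `x`. -/
def isVar {C : Type*} (x : ℕ) : Term ℕ C → Bool
  | .var y => x == y
  | .cst _ => false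

/-- The relational atom with tid term `t` and with fresh variables in the `n` further positions. -/
def freshAtom (r : R) (t : PTerm O V T) (k n : ℕ) : PAtom R Q O V T :=
  ⟨.rel r, t :: (List.range n).map fun j => .var (.occ k (j + 1))⟩

/-- The renamed relational atoms of a query. -/
def relAtoms (q : Query R Q (Const O V T)) : List (PAtom R Q O V T) :=
  q.rels.zipIdx.map fun (a, k) => freshAtom a.rel (ofTerm a.tid) k a.args.length

/-- The atom which says that `c` belongs to the set of constants at the position of an
occurrence: `same(c, u)` in the tid position of an atom with tid term `u`, `Val(u, i, c)` in a
value position `i`, and `EqO(w, c)` in an object position with fresh variable `w`. -/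
def memAtom (S : Schema R) (o : Occ R (Const O V T)) (c : PTerm O V T) : List (PAtom R Q O V T) :=
  match o.i with
  | 0 => [⟨.same, [c, ofTerm o.atom.tid]⟩]
  | j + 1 =>
    match (S.ty o.atom.rel)[j]? with
    | some .val => [⟨.val, [ofTerm o.atom.tid, numT (j + 1), c]⟩]
    | some .obj => [⟨.eqO, [.var (.occ o.k (j + 1)), c]⟩]
    | none => []

/-- The variable occurs at least twice in the relational atoms. -/
def isJoin (q : Query R Q (Const O V T)) (x : ℕ) : Bool :=
  2 ≤ (q.occs.filter fun o => isVar x o.term).length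

/-- The atoms for the join variables and for the constants in the relational atoms of a query.
After the renaming, a join variable `x` itself serves as the fresh variable that stands for an
element common to the sets at all occurrences of `x`. -/
def joinAtoms (S : Schema R) (q : Query R Q (Const O V T)) : List (PAtom R Q O V T) :=
  q.occs.flatMap fun o =>
    match o.i, o.term with
    | 0, _ => []
    | _ + 1, .var x => if isJoin q x then memAtom S o (.var (.orig x)) else []
    | _ + 1, .cst c => memAtom S o (.cst (.inl c))

/-- The term that stands for a side `u` of a similarity atom: the fresh variable `w` if `u` is a
variable, and `u` itself if it is a constant. -/
def simTerm (w : PVar) : Term ℕ (Const O V T) → PTerm O V T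
  | .var _ => .var w
  | .cst c => .cst (.inl c)

/-- For a variable `x` in a similarity atom: the atoms `Val(u, i, w)` for all occurrences of `x`
in value positions. -/
def simSide (S : Schema R) (q : Query R Q (Const O V T)) (w : PVar) :
    Term ℕ (Const O V T) → List (PAtom R Q O V T)
  | .cst _ => []
  | .var x => q.occs.flatMap fun o =>
      match o.i, isVar x o.term with
      | j + 1, true =>
        match (S.ty o.atom.rel)[j]? with
        | some .val => [⟨.val, [ofTerm o.atom.tid, numT (j + 1), .var w]⟩]
        | _ => []
      | _, _ => []

/-- The translation of the similarity atoms of a query. -/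
def simAtoms (S : Schema R) (q : Query R Q (Const O V T)) : List (PAtom R Q O V T) :=
  q.sims.zipIdx.flatMap fun (s, n) =>
    simSide S q (.witL n) s.2.1 ++ simSide S q (.witR n) s.2.2 ++
      [⟨.sim s.1, [simTerm (.witL n) s.2.1, simTerm (.witR n) s.2.2]⟩]

/-- The translation of the relational and similarity atoms of a query. -/
def body (S : Schema R) (q : Query R Q (Const O V T)) : List (PAtom R Q O V T) :=
  relAtoms q ++ joinAtoms S q ++ simAtoms S q

/-- The fresh variable at the first occurrence of `x`. -/
def pick (q : Query R Q (Const O V T)) (x : ℕ) : PTerm O V T :=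
  match q.occs.find? fun o => isVar x o.term with
  | some o => .var (.occ o.k o.i)
  | none => .var (.orig x)

/-- The translation of a rule for objects, with head predicate `EqO` (hard) or `ActiveO` (soft). -/
def objRule {S : Schema R} (h : PPred R Q O V T) (r : ObjRule S Q O V T) : PRule R Q O V T where
  head := some ⟨h, [pick r.q r.x, pick r.q r.y]⟩
  pos := body S r.q

/-- The translation of a rule for values, with head predicate `EqV` (hard) or `ActiveV` (soft). -/
def valRule {S : Schema R} (h : PPred R Q O V T) (r : ValRule S Q O V T) : PRule R Q O V T where
  head := some ⟨h, [.var (.orig r.x), numT r.i, .var (.orig r.y), numT r.j]⟩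
  pos := body S r.q

/-- The atoms which say that `c` belongs to the set assigned to the term `u` of the query. -/
def memTerm (S : Schema R) (q : Query R Q (Const O V T)) (c : PTerm O V T) :
    Term ℕ (Const O V T) → List (PAtom R Q O V T)
  | .cst a => [⟨.same, [c, .cst (.inl a)]⟩]
  | .var x => (q.occs.filter fun o => isVar x o.term).flatMap fun o => memAtom S o c

/-- The atom which says, in terms of the tids of the relational atoms, that the sets assigned to
the two sides of the `j`-th inequality atom have a common element. -/
def commonAtom (q : Query R Q (Const O V T)) (j : ℕ) : PAtom R Q O V T :=
  ⟨.common q j, q.rels.map fun a => ofTerm a.tid⟩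

/-- The rules that define the predicates `common q j`. -/
def commonRules (S : Schema R) (q : Query R Q (Const O V T)) : List (PRule R Q O V T) :=
  q.neqs.zipIdx.map fun (s, j) =>
    { head := some (commonAtom q j)
      pos := relAtoms q ++ memTerm S q (auxT 0) s.1 ++ memTerm S q (auxT 0) s.2 }

/-- The constants on either side of an inequality atom are constants of the database. -/
def neqGuard (q : Query R Q (Const O V T)) : List (PAtom R Q O V T) :=
  q.neqs.flatMap fun s => [s.1, s.2].flatMap fun u =>
    match u with
    | .cst a => [⟨.same, [.cst (.inl a), .cst (.inl a)]⟩]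
    | .var _ => []

/-- The constraint that translates a denial constraint. -/
def denialRule (S : Schema R) (q : Query R Q (Const O V T)) : PRule R Q O V T where
  head := none
  pos := relAtoms q ++ joinAtoms S q ++ neqGuard q
  neg := q.neqs.zipIdx.map fun (_, j) => commonAtom q j

/-- The rules for one relation symbol `r`: `Tid(u) ← r(u, …)`, `Proj(u, i, v) ← r(u, …, v, …)` for
all positions `i`, `Obj(v) ← r(u, …, v, …)` for the object positions, and `Valpos(u, i) ← r(u, …)`
for the value positions. -/
def relRules (S : Schema R) (r : R) : List (PRule R Q O V T) :=
  let b : PAtom R Q O V T := freshAtom r (.var (.occ 0 0)) 0 (S.ty r).length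
  { head := some ⟨.tid, [.var (.occ 0 0)]⟩, pos := [b] } ::
    (S.ty r).zipIdx.flatMap fun (s, j) =>
      { head := some ⟨.proj, [.var (.occ 0 0), numT (j + 1), .var (.occ 0 (j + 1))]⟩,
        pos := [b] } ::
      match s with
      | .obj => [{ head := some ⟨.obj, [.var (.occ 0 (j + 1))]⟩, pos := [b] }]
      | .val => [{ head := some ⟨.valpos, [.var (.occ 0 0), numT (j + 1)]⟩, pos := [b] }]

/-- The rules that do not depend on the specification. -/
def genericRules : List (PRule R Q O V T) :=
  let a : PTerm O V T := auxT 0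
  let b : PTerm O V T := auxT 1
  let c : PTerm O V T := auxT 2
  let d : PTerm O V T := auxT 3
  let e : PTerm O V T := auxT 4
  let f : PTerm O V T := auxT 5
  [ -- `Val(a, b, c) ← EqV(a, b, d, e), Proj(d, e, c)`
    { head := some ⟨.val, [a, b, c]⟩, pos := [⟨.eqV, [a, b, d, e]⟩, ⟨.proj, [d, e, c]⟩] },
    -- equality on the constants of the database
    { head := some ⟨.same, [a, a]⟩, pos := [⟨.tid, [a]⟩] },
    { head := some ⟨.same, [a, a]⟩, pos := [⟨.proj, [b, c, a]⟩] },
    -- `EqO` is an equivalence relation on the objects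
    { head := some ⟨.eqO, [a, a]⟩, pos := [⟨.obj, [a]⟩] },
    { head := some ⟨.eqO, [a, b]⟩, pos := [⟨.eqO, [b, a]⟩] },
    { head := some ⟨.eqO, [a, c]⟩, pos := [⟨.eqO, [a, b]⟩, ⟨.eqO, [b, c]⟩] },
    -- `EqV` is an equivalence relation on the value cells
    { head := some ⟨.eqV, [a, b, a, b]⟩, pos := [⟨.tid, [a]⟩, ⟨.valpos, [a, b]⟩] },
    { head := some ⟨.eqV, [a, b, c, d]⟩, pos := [⟨.eqV, [c, d, a, b]⟩] },
    { head := some ⟨.eqV, [a, b, e, f]⟩,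
      pos := [⟨.eqV, [a, b, c, d]⟩, ⟨.eqV, [c, d, e, f]⟩] },
    -- the choice between applying a soft rule and not applying it
    { head := some ⟨.eqO, [a, b]⟩, pos := [⟨.activeO, [a, b]⟩], neg := [⟨.neqO, [a, b]⟩] },
    { head := some ⟨.neqO, [a, b]⟩, pos := [⟨.activeO, [a, b]⟩], neg := [⟨.eqO, [a, b]⟩] },
    { head := some ⟨.eqV, [a, b, c, d]⟩, pos := [⟨.activeV, [a, b, c, d]⟩],
      neg := [⟨.neqV, [a, b, c, d]⟩] },
    { head := some ⟨.neqV, [a, b, c, d]⟩, pos := [⟨.activeV, [a, b, c, d]⟩],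
      neg := [⟨.eqV, [a, b, c, d]⟩] } ]

/-- The normal logic program of a specification. -/
noncomputable def piSol [Fintype R] {S : Schema R} (Sp : Spec S Q O V T) :
    List (PRule R Q O V T) :=
  genericRules ++
  (Finset.univ : Finset R).toList.flatMap (relRules S) ++
  Sp.hardO.toList.map (objRule .eqO) ++
  Sp.softO.toList.map (objRule .activeO) ++
  Sp.hardV.toList.map (valRule .eqV) ++
  Sp.softV.toList.map (valRule .activeV) ++
  Sp.denials.toList.flatMap (fun d => denialRule S d.q :: commonRules S d.q)

/-- The facts given to the program: those of the database, and the extension of the similarity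
predicates on the values of the database. -/
def inputFacts {S : Schema R} (sim : Q → V → V → Prop) (D : Database S O V T) :
    Set (GAtom R Q O V T) :=
  {a | (∃ f ∈ D.facts, a = ⟨.rel f.rel, .inl (.tid f.tid) :: f.args.map .inl⟩) ∨
    ∃ p c d, c ∈ D.dom ∧ d ∈ D.dom ∧ SimConst sim p c d ∧ a = ⟨.sim p, [.inl c, .inl d]⟩}

end Program

end Lace

/-!
The proof compares two readings of a pair `⟨E, W⟩` of equivalence relations: the induced database,
and the set `baseAtoms` of ground atoms that hold when `EqO` and `EqV` are interpreted by `E` and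
`W`.

*Queries.* A query is satisfied in the induced database iff one can match its relational atoms with
facts and choose one element for each variable, common to the sets at all its occurrences
(`Witness`, `sat_subst_iff`). The head variables are treated like all other variables, so that the
answers are the pairs of elements chosen for them. Up to the choice for variables that occur once,
such a witness is the same as a substitution under which the translated body is contained in
`baseAtoms` (`witness_of_allIn`, `Witness.exists_subst`). Hence a translated rule for objects
derives the answers to its body up to `E`-equivalence, a rule for values derives exactly the answers, and a
denial constraint is violated iff its translation is (`Denial.sat_iff_commonAtoms`); the latter uses
that the tids of the relational atoms determine the matched facts.

*Solutions yield stable models.* `solModel` consists of `baseAtoms` and of what is derived from it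
in one step. For minimality, every merge in a derivation of the candidate solution is forced in each
model of the reduct, by induction on the derivation
(`IsCandidate.subset_of_isModelOfReduct`): answers persist, as the relations only grow towards
`⟨E, W⟩`, and the choice rules for the merges in `⟨E, W⟩` survive in the reduct.

*Stable models yield solutions.* Let `⟨E, W⟩` be read off from a stable model `M`. As the database
is finite, there is a maximal candidate solution below `⟨E, W⟩`. The part of `M` that it supports
(`supportedPart`) is a model of the reduct: a merge that is applicable and contained in `M` has been
performed, by maximality. Hence that part is all of `M`, by minimality of `M`
(`IsStableModel.exists_candidate`). So `⟨E, W⟩` is itself a candidate solution, and `M` contains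
precisely the atoms of `baseAtoms` over the base predicates. Hard rules and denial constraints
are then satisfied because `M` satisfies their translations.
-/

namespace Lace

/-! ### Occurrences and substitution in queries -/

namespace Query

variable {R Q C : Type*}

theorem mem_occs {q : Query R Q C} {o : Occ R C} :
    o ∈ q.occs ↔ q.rels[o.k]? = some o.atom ∧ (o.atom.tid :: o.atom.args)[o.i]? = some o.term := by
  obtain ⟨k, i, a, u⟩ := o
  simp only [occs, List.mem_flatMap, List.mem_map, Prod.exists, List.mem_zipIdx_iff_getElem?]
  constructor
  · rintro ⟨a', k', h, u', i', h', he⟩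
    cases he
    exact ⟨h, h'⟩
  · rintro ⟨h, h'⟩
    exact ⟨a, k, h, u, i, h', rfl⟩

/-- Replacement of the variables in the domain of the partial assignment `ρ`. -/
def substTerm (ρ : ℕ → Option C) : Term ℕ C → Term ℕ C
  | .var z => match ρ z with
    | some c => .cst c
    | none => .var z
  | .cst a => .cst a

/-- The instance of a query under a partial assignment of constants to its variables. It covers
both `q` (nothing is assigned) and `q[c, d]`. -/
def subst (ρ : ℕ → Option C) (q : Query R Q C) : Query R Q C where
  rels := q.rels.map fun a => ⟨a.rel, substTerm ρ a.tid, a.args.map (substTerm ρ)⟩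
  sims := q.sims.map fun s => (s.1, substTerm ρ s.2.1, substTerm ρ s.2.2)
  neqs := q.neqs.map fun s => (substTerm ρ s.1, substTerm ρ s.2)

theorem substTerm_none : substTerm (fun _ => (none : Option C)) = id := by
  funext u; cases u <;> rfl

theorem subst_none (q : Query R Q C) : q.subst (fun _ => none) = q := by
  simp [subst, substTerm_none]

theorem inst_eq_subst (q : Query R Q C) (x y : ℕ) (c d : C) :
    q.inst x y c d =
      q.subst fun z => if z = x then some c else if z = y then some d else none := by
  have : (instTerm x y c d : Term ℕ C → Term ℕ C) =
      substTerm fun z => if z = x then some c else if z = y then some d else none := by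
    funext u
    cases u with
    | var z =>
      simp only [instTerm, substTerm]
      split_ifs <;> rfl
    | cst a => rfl
  simp [inst, subst, this]

theorem mem_occs_subst {ρ : ℕ → Option C} {q : Query R Q C} {o : Occ R C} :
    o ∈ (q.subst ρ).occs ↔ ∃ o' ∈ q.occs,
      o = ⟨o'.k, o'.i, ⟨o'.atom.rel, substTerm ρ o'.atom.tid, o'.atom.args.map (substTerm ρ)⟩,
        substTerm ρ o'.term⟩ := by
  obtain ⟨k, i, a, u⟩ := o
  simp only [mem_occs, subst, List.getElem?_map, Option.map_eq_some_iff]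
  constructor
  · rintro ⟨⟨a', h, rfl⟩, h'⟩
    simp only [← List.map_cons, List.getElem?_map, Option.map_eq_some_iff] at h'
    obtain ⟨u', h', rfl⟩ := h'
    exact ⟨⟨k, i, a', u'⟩, ⟨h, h'⟩, rfl⟩
  · rintro ⟨⟨k', i', a', u'⟩, ⟨h, h'⟩, he⟩
    cases he
    refine ⟨⟨a', h, rfl⟩, ?_⟩
    simp only at h'
    simp [← List.map_cons, List.getElem?_map, h']

theorem substTerm_eq_var {ρ : ℕ → Option C} {u : Term ℕ C} {z : ℕ} :
    substTerm ρ u = .var z ↔ u = .var z ∧ ρ z = none := by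
  cases u with
  | cst a => simp [substTerm]
  | var y =>
    simp only [substTerm]
    cases h : ρ y with
    | none =>
      simp only [Term.var.injEq]
      constructor
      · rintro rfl; exact ⟨rfl, h⟩
      · exact And.left
    | some c =>
      simp only [reduceCtorEq, Term.var.injEq, false_iff, not_and]
      rintro rfl; simp [h]

theorem substTerm_of_not_mem {ρ : ℕ → Option C} {u : Term ℕ C}
    (h : ∀ z, u = .var z → ρ z = none) : substTerm ρ u = u := by
  cases u with
  | cst a => rfl
  | var y => simp [substTerm, h y rfl]

theorem termSet_subst {ρ : ℕ → Option C} {q : Query R Q C} {B : Set C} {g : ℕ → ℕ → Set C}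
    {u : Term ℕ C} (h : ∀ z, u = .var z → ρ z = none) :
    (q.subst ρ).termSet B g u = q.termSet B g u := by
  cases u with
  | cst a => rfl
  | var y =>
    ext c
    simp only [termSet, Set.mem_ofPred_eq, mem_occs_subst]
    refine and_congr_right fun _ => ⟨fun H o ho e => ?_, ?_⟩
    · have := H _ ⟨o, ho, rfl⟩ (substTerm_eq_var.2 ⟨e, h y rfl⟩)
      exact this
    · rintro H _ ⟨o, ho, rfl⟩ e
      exact H o ho (substTerm_eq_var.1 e).1

end Query

/-! ### Equivalence relations generated on a set -/

/-- `P` is an equivalence relation on the set `A`, as a set of pairs. -/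
structure IsEquivOn {α : Type*} (P : Set (α × α)) (A : Set α) : Prop where
  left_mem : ∀ {a b}, (a, b) ∈ P → a ∈ A
  refl : ∀ {a}, a ∈ A → (a, a) ∈ P
  symm : ∀ {a b}, (a, b) ∈ P → (b, a) ∈ P
  trans : ∀ {a b c}, (a, b) ∈ P → (b, c) ∈ P → (a, c) ∈ P

namespace IsEquivOn

variable {α : Type*} {P : Set (α × α)} {A : Set α}

theorem right_mem (h : IsEquivOn P A) {a b : α} (hab : (a, b) ∈ P) : b ∈ A :=
  h.left_mem (h.symm hab)

theorem subset_prod (h : IsEquivOn P A) : P ⊆ A ×ˢ A :=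
  fun _ hp => ⟨h.left_mem hp, h.right_mem hp⟩

end IsEquivOn

section EqRel

variable {α : Type*} {P P' : Set (α × α)} {A : Set α}

theorem isEquivOn_eqRel (h : P ⊆ A ×ˢ A) : IsEquivOn (eqRel P A) A := by
  have key : ∀ {a b}, EqGen P A a b → a ∈ A ∧ b ∈ A := by
    intro a b hab
    induction hab with
    | base hab => exact h hab
    | refl ha => exact ⟨ha, ha⟩
    | symm _ ih => exact ih.symm
    | trans _ _ ih₁ ih₂ => exact ⟨ih₁.1, ih₂.2⟩
  exact ⟨fun hab => (key hab).1, .refl, .symm, .trans⟩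

/-- `P'` is not required to be contained in `A × A`, so that the lemma applies to the relations
that are read off from an arbitrary model of the program. -/
theorem eqRel_subset (h : P ⊆ P') (refl : ∀ a ∈ A, (a, a) ∈ P')
    (symm : ∀ a b, (a, b) ∈ P' → (b, a) ∈ P')
    (trans : ∀ a b c, (a, b) ∈ P' → (b, c) ∈ P' → (a, c) ∈ P') : eqRel P A ⊆ P' := by
  rintro ⟨a, b⟩ hab
  change EqGen P A a b at hab
  induction hab with
  | base hab => exact h hab
  | refl ha => exact refl _ ha
  | symm _ ih => exact symm _ _ ih
  | trans _ _ ih₁ ih₂ => exact trans _ _ _ ih₁ ih₂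

theorem subset_eqRel : P ⊆ eqRel P A := fun _ h => .base h

end EqRel

/-! ### Databases -/

namespace Database

variable {R O V T : Type*} {S : Schema R} {D : Database S O V T}

theorem exists_arg {f : Fact R O V T} (hf : f ∈ D.facts) {j : ℕ} {s : Srt}
    (h : (S.ty f.rel)[j]? = some s) : ∃ c, f.args[j]? = some c ∧ c.HasSrt s := by
  obtain ⟨hl, H⟩ := List.forall₂_iff_get.1 (D.typed f hf)
  obtain ⟨hj, rfl⟩ := List.getElem?_eq_some_iff.1 h
  exact ⟨_, List.getElem?_eq_getElem (hl ▸ hj), H j (hl ▸ hj) hj⟩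

theorem exists_ty {f : Fact R O V T} (hf : f ∈ D.facts) {j : ℕ} {c : Const O V T}
    (h : f.args[j]? = some c) : ∃ s, (S.ty f.rel)[j]? = some s ∧ c.HasSrt s := by
  obtain ⟨hl, H⟩ := List.forall₂_iff_get.1 (D.typed f hf)
  obtain ⟨hj, rfl⟩ := List.getElem?_eq_some_iff.1 h
  exact ⟨_, List.getElem?_eq_getElem (hl ▸ hj), H j hj (hl ▸ hj)⟩

theorem length_args {f : Fact R O V T} (hf : f ∈ D.facts) :
    f.args.length = (S.ty f.rel).length :=
  (D.typed f hf).length_eq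

theorem tid_mem_dom {f : Fact R O V T} (hf : f ∈ D.facts) : .tid f.tid ∈ D.dom :=
  ⟨f, hf, .inl rfl⟩

theorem arg_mem_dom {f : Fact R O V T} (hf : f ∈ D.facts) {j : ℕ} {c : Const O V T}
    (h : f.args[j]? = some c) : c ∈ D.dom :=
  ⟨f, hf, .inr (List.mem_of_getElem? h)⟩

theorem EntryIs.mem_dom {p : Cell T} {c : Const O V T} (h : D.EntryIs p c) : c ∈ D.dom := by
  obtain ⟨f, hf, -, j, -, hj⟩ := h
  exact arg_mem_dom hf hj

theorem EntryIs.isVal {p : Cell T} {c : Const O V T} (hp : p ∈ D.cells) (h : D.EntryIs p c) :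
    c.HasSrt .val := by
  obtain ⟨f, hf, ht, j, hj, hc⟩ := h
  obtain ⟨f', hf', ht', j', hj', hs⟩ := hp
  obtain rfl := D.tid_unique f hf f' hf' (ht.symm.trans ht')
  obtain rfl : j = j' := by omega
  obtain ⟨c', hc', h⟩ := exists_arg hf hs
  rw [hc] at hc'
  cases hc'
  exact h

theorem mem_objs_of_arg {f : Fact R O V T} (hf : f ∈ D.facts) {j : ℕ} {o : O}
    (h : f.args[j]? = some (.obj o)) : Const.obj o ∈ D.objs :=
  ⟨o, rfl, arg_mem_dom hf h⟩

theorem exists_arg_of_mem_objs {c : Const O V T} (h : c ∈ D.objs) :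
    ∃ f ∈ D.facts, ∃ j : ℕ, f.args[j]? = some c ∧ (S.ty f.rel)[j]? = some .obj := by
  obtain ⟨o, rfl, f, hf, h | h⟩ := h
  · cases h
  · obtain ⟨j, hj⟩ := List.mem_iff_getElem?.1 h
    obtain ⟨s, hs, hs'⟩ := exists_ty hf hj
    cases s
    · exact ⟨f, hf, j, hj, hs⟩
    · cases hs'

theorem finite_dom : D.dom.Finite := by
  have : D.dom = ⋃ f ∈ D.facts, {c | c = .tid f.tid ∨ c ∈ f.args} := by
    ext c; simp [dom]
  rw [this]
  refine D.finite.biUnion fun f _ => ?_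
  exact ((Set.finite_singleton _).union f.args.finite_toSet).subset fun c h => h

theorem finite_objs : D.objs.Finite := by
  refine (finite_dom (D := D)).subset ?_
  rintro _ ⟨o, rfl, h⟩
  exact h

theorem finite_cells : D.cells.Finite := by
  refine (D.finite.biUnion (t := fun f =>
    (fun i => (f.tid, i)) '' Set.Iic (S.ty f.rel).length) fun f _ =>
      (Set.finite_Iic _).image _).subset ?_
  rintro ⟨t, i⟩ ⟨f, hf, ht, j, hj, hs⟩
  obtain ⟨hj', -⟩ := List.getElem?_eq_some_iff.1 hs
  simp only at ht hj
  simp only [Set.mem_iUnion]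
  exact ⟨f, hf, i, by simp only [Set.mem_Iic]; omega, by rw [ht]⟩

section ExtArgs

variable {E : Set (Const O V T × Const O V T)} {W : Set (Cell T × Cell T)} {f : Fact R O V T}

theorem mem_extArgs_obj (hf : f ∈ D.facts) {j : ℕ} (h : (S.ty f.rel)[j]? = some .obj) :
    ∃ o, f.args[j]? = some (.obj o) ∧ ∀ c, c ∈ D.extArgs E W f (j + 1) ↔ (.obj o, c) ∈ E := by
  obtain ⟨c, hc, hs⟩ := exists_arg hf h
  cases c with
  | obj o => exact ⟨o, hc, fun c => by simp [extArgs, hc]⟩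
  | val _ => exact hs.elim
  | tid _ => exact hs.elim

theorem mem_extArgs_val (hf : f ∈ D.facts) {j : ℕ} (h : (S.ty f.rel)[j]? = some .val) {c} :
    c ∈ D.extArgs E W f (j + 1) ↔ ∃ p, ((f.tid, j + 1), p) ∈ W ∧ D.EntryIs p c := by
  obtain ⟨c, hc, hs⟩ := exists_arg hf h
  cases c with
  | val v => simp [extArgs, hc]
  | obj _ => exact hs.elim
  | tid _ => exact hs.elim

theorem arg_mem_extArgs (hE : IsEquivOn E D.objs) (hW : IsEquivOn W D.cells) (hf : f ∈ D.facts)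
    {j : ℕ} {c : Const O V T} (h : f.args[j]? = some c) : c ∈ D.extArgs E W f (j + 1) := by
  obtain ⟨s, hs, -⟩ := exists_ty hf h
  cases s with
  | obj =>
    obtain ⟨o, ho, H⟩ := mem_extArgs_obj (E := E) (W := W) hf hs
    rw [h] at ho
    cases ho
    exact (H _).2 (hE.refl (mem_objs_of_arg hf h))
  | val =>
    exact (mem_extArgs_val hf hs).2
      ⟨_, hW.refl ⟨f, hf, rfl, j, rfl, hs⟩, f, hf, rfl, j, rfl, h⟩

theorem extArgs_hasSrt (hE : IsEquivOn E D.objs) (hW : IsEquivOn W D.cells) (hf : f ∈ D.facts)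
    {j : ℕ} {s : Srt} (h : (S.ty f.rel)[j]? = some s) {c : Const O V T}
    (hc : c ∈ D.extArgs E W f (j + 1)) : c.HasSrt s := by
  cases s with
  | obj =>
    obtain ⟨o, -, H⟩ := mem_extArgs_obj (E := E) (W := W) hf h
    obtain ⟨o', rfl, -⟩ := hE.right_mem ((H c).1 hc)
    trivial
  | val =>
    obtain ⟨p, hp, hp'⟩ := (mem_extArgs_val hf h).1 hc
    exact hp'.isVal (hW.right_mem hp)

theorem extArgs_subset_dom (hE : IsEquivOn E D.objs) (hf : f ∈ D.facts) (i : ℕ) :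
    D.extArgs E W f i ⊆ D.dom := by
  intro c hc
  cases i with
  | zero =>
    obtain rfl : c = .tid f.tid := hc
    exact tid_mem_dom hf
  | succ j =>
    cases hj : f.args[j]? with
    | none => simp [extArgs, hj] at hc
    | some a =>
      obtain ⟨s, hs, -⟩ := exists_ty hf hj
      cases s with
      | obj =>
        obtain ⟨o, -, H⟩ := mem_extArgs_obj (E := E) (W := W) hf hs
        obtain ⟨o', rfl, h⟩ := hE.right_mem ((H c).1 hc)
        exact h
      | val =>
        obtain ⟨p, -, hp'⟩ := (mem_extArgs_val hf hs).1 hc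
        exact hp'.mem_dom

end ExtArgs

end Database

/-! ### The ground atoms that hold for a pair of equivalence relations -/

section BaseAtoms

variable {R Q O V T : Type*} {S : Schema R}

/-- The ground atoms over the input predicates, the equivalences and the predicates defined from
them that are true when `EqO` and `EqV` are interpreted by `E` and `W`. -/
def baseAtoms (sim : Q → V → V → Prop) (D : Database S O V T)
    (E : Set (Const O V T × Const O V T)) (W : Set (Cell T × Cell T)) : Set (GAtom R Q O V T) :=
  {a | match a.pred with
    | .rel r => ∃ f ∈ D.facts, f.rel = r ∧ a.args = .inl (.tid f.tid) :: f.args.map .inl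
    | .sim p => ∃ c d, c ∈ D.dom ∧ d ∈ D.dom ∧ SimConst sim p c d ∧ a.args = [.inl c, .inl d]
    | .tid => ∃ f ∈ D.facts, a.args = [.inl (.tid f.tid)]
    | .proj => ∃ p c, D.EntryIs p c ∧ a.args = [.inl (.tid p.1), .inr p.2, .inl c]
    | .obj => ∃ c ∈ D.objs, a.args = [.inl c]
    | .valpos => ∃ p ∈ D.cells, a.args = [.inl (.tid p.1), .inr p.2]
    | .val => ∃ p p' c, (p, p') ∈ W ∧ D.EntryIs p' c ∧
        a.args = [.inl (.tid p.1), .inr p.2, .inl c]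
    | .eqO => ∃ c d, (c, d) ∈ E ∧ a.args = [.inl c, .inl d]
    | .eqV => ∃ p p', (p, p') ∈ W ∧
        a.args = [.inl (.tid p.1), .inr p.2, .inl (.tid p'.1), .inr p'.2]
    | .same => ∃ c ∈ D.dom, a.args = [.inl c, .inl c]
    | _ => False}

/-- The predicates of `baseAtoms`. Rule bodies contain no other predicates, except for those of the
choice rules and the negative literals of the denial constraints. -/
def Pred.IsBase {C : Type*} : Pred R Q C → Prop
  | .activeO | .activeV | .neqO | .neqV | .common _ _ => False
  | _ => True

/-- All ground instances under `σ` of the atoms in `l` belong to `B`. -/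
def AllIn {P X K : Type*} (B : Set (Atom P K)) (σ : X → K) (l : List (Atom P (Term X K))) : Prop :=
  ∀ b ∈ l, b.ground σ ∈ B

variable {sim : Q → V → V → Prop} {D : Database S O V T}
  {E : Set (Const O V T × Const O V T)} {W : Set (Cell T × Cell T)}
  {args : List (GTerm O V T)}

theorem rel_mem_baseAtoms {r : R} : (⟨.rel r, args⟩ : GAtom R Q O V T) ∈ baseAtoms sim D E W ↔
    ∃ f ∈ D.facts, f.rel = r ∧ args = .inl (.tid f.tid) :: f.args.map .inl := Iff.rfl

theorem sim_mem_baseAtoms {p : Q} : (⟨.sim p, args⟩ : GAtom R Q O V T) ∈ baseAtoms sim D E W ↔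
    ∃ c d, c ∈ D.dom ∧ d ∈ D.dom ∧ SimConst sim p c d ∧ args = [.inl c, .inl d] := Iff.rfl

theorem tid_mem_baseAtoms : (⟨.tid, args⟩ : GAtom R Q O V T) ∈ baseAtoms sim D E W ↔
    ∃ f ∈ D.facts, args = [.inl (.tid f.tid)] := Iff.rfl

theorem proj_mem_baseAtoms : (⟨.proj, args⟩ : GAtom R Q O V T) ∈ baseAtoms sim D E W ↔
    ∃ p c, D.EntryIs p c ∧ args = [.inl (.tid p.1), .inr p.2, .inl c] := Iff.rfl

theorem obj_mem_baseAtoms : (⟨.obj, args⟩ : GAtom R Q O V T) ∈ baseAtoms sim D E W ↔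
    ∃ c ∈ D.objs, args = [.inl c] := Iff.rfl

theorem valpos_mem_baseAtoms : (⟨.valpos, args⟩ : GAtom R Q O V T) ∈ baseAtoms sim D E W ↔
    ∃ p ∈ D.cells, args = [.inl (.tid p.1), .inr p.2] := Iff.rfl

theorem val_mem_baseAtoms : (⟨.val, args⟩ : GAtom R Q O V T) ∈ baseAtoms sim D E W ↔
    ∃ p p' c, (p, p') ∈ W ∧ D.EntryIs p' c ∧
      args = [.inl (.tid p.1), .inr p.2, .inl c] := Iff.rfl

theorem eqO_mem_baseAtoms : (⟨.eqO, args⟩ : GAtom R Q O V T) ∈ baseAtoms sim D E W ↔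
    ∃ c d, (c, d) ∈ E ∧ args = [.inl c, .inl d] := Iff.rfl

theorem eqV_mem_baseAtoms : (⟨.eqV, args⟩ : GAtom R Q O V T) ∈ baseAtoms sim D E W ↔
    ∃ p p', (p, p') ∈ W ∧
      args = [.inl (.tid p.1), .inr p.2, .inl (.tid p'.1), .inr p'.2] := Iff.rfl

theorem same_mem_baseAtoms : (⟨.same, args⟩ : GAtom R Q O V T) ∈ baseAtoms sim D E W ↔
    ∃ c ∈ D.dom, args = [.inl c, .inl c] := Iff.rfl

theorem isBase_of_mem_baseAtoms {a : GAtom R Q O V T} (h : a ∈ baseAtoms sim D E W) :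
    a.pred.IsBase := by
  obtain ⟨p, args⟩ := a
  cases p <;> trivial

end BaseAtoms

/-! ### Matching the relational atoms of a query with facts -/

section Match

variable {R Q O V T : Type*} {S : Schema R} {sim : Q → V → V → Prop} {D : Database S O V T}
  {E : Set (Const O V T × Const O V T)} {W : Set (Cell T × Cell T)}
  {q : Query R Q (Const O V T)} {σ : PVar → GTerm O V T}

/-- The value of a query term when `val` assigns ground terms to the variables. Values in `GTerm`
rather than in `Const` avoid a case distinction when there are no constants at all. -/
def termValue (val : ℕ → GTerm O V T) : Term ℕ (Const O V T) → GTerm O V T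
  | .var z => val z
  | .cst c => .inl c

theorem ground_var (x : PVar) : (Term.var x : PTerm O V T).ground σ = σ x := rfl

theorem ground_cst (c : GTerm O V T) : (Term.cst c : PTerm O V T).ground σ = c := rfl

theorem ground_numT (i : ℕ) : (numT i : PTerm O V T).ground σ = .inr i := rfl

theorem ground_ofTerm (u : Term ℕ (Const O V T)) :
    (ofTerm u).ground σ = termValue (fun z => σ (.orig z)) u := by
  cases u <;> rfl

/-- The `k`-th relational atom `a`, after the renaming, is mapped by `σ` to the fact `f`. -/
structure Fits (D : Database S O V T) (σ : PVar → GTerm O V T) (k : ℕ)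
    (a : RelAtom R (Const O V T)) (f : Fact R O V T) : Prop where
  mem : f ∈ D.facts
  rel : f.rel = a.rel
  tid : (ofTerm a.tid).ground σ = .inl (.tid f.tid)
  arg : ∀ {j c}, f.args[j]? = some c → σ (.occ k (j + 1)) = .inl c

theorem map_range_eq_map_iff {α β : Type*} {n : ℕ} {φ : ℕ → β} {ψ : α → β} {l : List α} :
    (List.range n).map φ = l.map ψ ↔ n = l.length ∧ ∀ j c, l[j]? = some c → φ j = ψ c := by
  constructor
  · intro h
    have hn : n = l.length := by simpa using congrArg List.length h
    refine ⟨hn, fun j c hj => ?_⟩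
    have := congrArg (fun l : List β => l[j]?) h
    have hj' : j < n := by rw [hn]; exact (List.getElem?_eq_some_iff.1 hj).1
    simpa [hj, hj'] using this
  · rintro ⟨rfl, h⟩
    refine List.ext_getElem (by simp) fun j h₁ h₂ => ?_
    simp only [List.length_map] at h₂
    simpa using h j l[j] (List.getElem?_eq_getElem h₂)

theorem relAtoms_allIn_iff (wf : q.WF S) :
    AllIn (baseAtoms sim D E W) σ (relAtoms q) ↔
      ∀ k a, q.rels[k]? = some a → ∃ f, Fits D σ k a f := by
  have key : ∀ k a, q.rels[k]? = some a →
      ((freshAtom a.rel (ofTerm a.tid) k a.args.length : PAtom R Q O V T).ground σ ∈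
        baseAtoms sim D E W ↔ ∃ f, Fits D σ k a f) := by
    intro k a ha
    have hl := wf.arity a (List.mem_of_getElem? ha)
    simp only [freshAtom, Atom.ground, rel_mem_baseAtoms, List.map_cons, List.map_map,
      List.cons.injEq, map_range_eq_map_iff]
    constructor
    · rintro ⟨f, hf, hr, ht, -, h⟩
      exact ⟨f, hf, hr, ht, fun hj => h _ _ hj⟩
    · rintro ⟨f, hf, hr, ht, h⟩
      exact ⟨f, hf, hr, ht, by rw [hl, ← hr, Database.length_args hf], fun j c hj => h hj⟩
  simp only [AllIn, relAtoms, List.forall_mem_map, Prod.forall, List.mem_zipIdx_iff_getElem?]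
  exact ⟨fun H k a h => (key k a h).1 (H a k h), fun H a k h => (key k a h).2 (H k a h)⟩

/-- The types of the positions of the atom of an occurrence. -/
theorem exists_ty_of_mem_occs (wf : q.WF S) {o : Occ R (Const O V T)} (ho : o ∈ q.occs) {j : ℕ}
    (hj : o.i = j + 1) : ∃ s, (S.ty o.atom.rel)[j]? = some s := by
  obtain ⟨h, h'⟩ := Query.mem_occs.1 ho
  rw [hj, List.getElem?_cons_succ] at h'
  have := (List.getElem?_eq_some_iff.1 h').1
  rw [wf.arity _ (List.mem_of_getElem? h)] at this
  exact ⟨_, List.getElem?_eq_getElem this⟩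

/-- The translation of membership in the set at an occurrence is correct. -/
theorem memAtom_allIn_iff (wf : q.WF S) {o : Occ R (Const O V T)} (ho : o ∈ q.occs)
    {f : Fact R O V T} (hf : Fits D σ o.k o.atom f) {c : PTerm O V T} :
    AllIn (baseAtoms sim D E W) σ (memAtom S o c : List (PAtom R Q O V T)) ↔
      ∃ c', c.ground σ = .inl c' ∧ c' ∈ D.extArgs E W f o.i := by
  unfold memAtom
  cases hi : o.i with
  | zero =>
    simp only [AllIn, List.forall_mem_singleton, Atom.ground, List.map_cons, List.map_nil,
      same_mem_baseAtoms, hf.tid, List.cons.injEq, and_true]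
    constructor
    · rintro ⟨c', hc', h, h'⟩
      exact ⟨c', h, (Sum.inl.inj h').symm⟩
    · rintro ⟨c', h, rfl⟩
      exact ⟨_, Database.tid_mem_dom hf.mem, h, rfl⟩
  | succ j =>
    obtain ⟨s, hs⟩ := exists_ty_of_mem_occs wf ho hi
    have hs' := hs
    rw [← hf.rel] at hs'
    cases s with
    | obj =>
      obtain ⟨b, hb, H⟩ := Database.mem_extArgs_obj (E := E) (W := W) hf.mem hs'
      simp only [hs, AllIn, List.forall_mem_singleton, Atom.ground, List.map_cons, List.map_nil,
        eqO_mem_baseAtoms, List.cons.injEq, and_true, ground_var, hf.arg hb, H, Sum.inl.injEq]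
      constructor
      · rintro ⟨_, c', h, rfl, h'⟩
        exact ⟨c', h', h⟩
      · rintro ⟨c', h', h⟩
        exact ⟨_, c', h, rfl, h'⟩
    | val =>
      simp only [hs, AllIn, List.forall_mem_singleton, Atom.ground, List.map_cons, List.map_nil,
        val_mem_baseAtoms, List.cons.injEq, and_true, hf.tid, Sum.inl.injEq,
        Database.mem_extArgs_val hf.mem hs', ground_numT, Sum.inr.injEq, Const.tid.injEq]
      constructor
      · rintro ⟨⟨t, i⟩, p', c', h, h', ht, hi, hc⟩
        simp only at ht hi
        subst ht hi
        exact ⟨c', hc, p', h, h'⟩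
      · rintro ⟨c', hc, p', h, h'⟩
        exact ⟨(f.tid, j + 1), p', c', h, h', rfl, rfl, hc⟩

end Match

/-! ### Satisfaction of a query through a choice of elements -/

section Witness

variable {R Q O V T : Type*} {S : Schema R} {sim : Q → V → V → Prop} {D : Database S O V T}
  {E : Set (Const O V T × Const O V T)} {W : Set (Cell T × Cell T)}
  {q : Query R Q (Const O V T)} {σ : PVar → GTerm O V T}

/-- Satisfaction of a query witnessed by the sets `g` at the positions of its relational atoms
together with the choice, for each variable, of one element common to the sets at all its
occurrences. Only the similarity and inequality atoms still refer to whole sets. -/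
structure Witness (sim : Q → V → V → Prop) (D : Database S O V T)
    (E : Set (Const O V T × Const O V T)) (W : Set (Cell T × Cell T))
    (q : Query R Q (Const O V T)) (val : ℕ → GTerm O V T) (g : ℕ → ℕ → Set (Const O V T)) :
    Prop where
  rels : ∀ k a, q.rels[k]? = some a → (a.rel, g k) ∈ D.induced E W
  occs : ∀ o ∈ q.occs, ∃ c ∈ g o.k o.i, termValue val o.term = .inl c
  neq_dom : ∀ s ∈ q.neqs, ∀ a, s.1 = .cst a ∨ s.2 = .cst a → a ∈ D.dom
  neqs : ∀ s ∈ q.neqs, q.termSet D.dom g s.1 ∩ q.termSet D.dom g s.2 = ∅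
  sims : ∀ s ∈ q.sims, ∃ c ∈ D.dom, ∃ d ∈ D.dom, c ∈ q.termSet D.dom g s.2.1 ∧
    d ∈ q.termSet D.dom g s.2.2 ∧ SimConst sim s.1 c d

theorem subset_dom_of_mem_induced (hE : IsEquivOn E D.objs) {r : R} {G : ℕ → Set (Const O V T)}
    (h : (r, G) ∈ D.induced E W) (i : ℕ) : G i ⊆ D.dom := by
  obtain ⟨f, hf, he⟩ := h
  cases he
  exact Database.extArgs_subset_dom hE hf i

/-- The assignment `ρ` of constants may only concern variables outside the built-in atoms. -/
theorem sat_subst_iff (wf : q.WF S) (hE : IsEquivOn E D.objs) {ρ : ℕ → Option (Const O V T)}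
    (hρ : ∀ z c, ρ z = some c → ¬ q.OccursBuiltin z) :
    Sat sim D E W (q.subst ρ) ↔
      ∃ val g, Witness sim D E W q val g ∧ ∀ z c, ρ z = some c → val z = .inl c := by
  have hnone : ∀ z, q.OccursBuiltin z → ρ z = none := fun z hz => by
    cases h : ρ z with
    | none => rfl
    | some c => exact absurd hz (hρ z c h)
  have hneq : ∀ s ∈ q.neqs, (∀ z, s.1 = .var z → ρ z = none) ∧
      ∀ z, s.2 = .var z → ρ z = none := fun s hs =>
    ⟨fun z h => hnone z (.inr ⟨s, hs, .inl h⟩), fun z h => hnone z (.inr ⟨s, hs, .inr h⟩)⟩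
  have hsim : ∀ s ∈ q.sims, (∀ z, s.2.1 = .var z → ρ z = none) ∧
      ∀ z, s.2.2 = .var z → ρ z = none := fun s hs =>
    ⟨fun z h => hnone z (.inl ⟨s, hs, .inl h⟩), fun z h => hnone z (.inl ⟨s, hs, .inr h⟩)⟩
  constructor
  · rintro ⟨g, hterm, hrel, hcst, hne, hsi⟩
    have hvar : ∀ z, ∃ v : GTerm O V T, (∀ c, ρ z = some c → v = .inl c) ∧
        (ρ z = none → q.OccursRel z → ∃ c, v = .inl c ∧
          c ∈ (q.subst ρ).termSet D.dom g (.var z)) := by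
      intro z
      cases hz : ρ z with
      | some c => exact ⟨.inl c, by simp, by simp⟩
      | none =>
        by_cases ho : q.OccursRel z
        · obtain ⟨o, ho, h⟩ := ho
          obtain ⟨c, hc⟩ := (hterm (.var z) (.inl
            ⟨_, Query.mem_occs_subst.2 ⟨o, ho, rfl⟩, Query.substTerm_eq_var.2 ⟨h, hz⟩⟩)).1
          exact ⟨.inl c, by simp, fun _ _ => ⟨c, rfl, hc⟩⟩
        · exact ⟨.inr 0, by simp, fun _ h => absurd h ho⟩
    choose val hval using hvar
    refine ⟨val, g, ⟨fun k a h => ?_, fun o ho => ?_, fun s hs a h => ?_, fun s hs => ?_,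
      fun s hs => ?_⟩, fun z => (hval z).1⟩
    · exact hrel k ⟨a.rel, Query.substTerm ρ a.tid, a.args.map (Query.substTerm ρ)⟩
        (by simp only [Query.subst, List.getElem?_map, h, Option.map_some])
    · have ho' := Query.mem_occs_subst (ρ := ρ).2 ⟨o, ho, rfl⟩
      cases ht : o.term with
      | cst a => exact ⟨a, hcst _ ho' a (by simp [ht, Query.substTerm]), rfl⟩
      | var z =>
        cases hz : ρ z with
        | some c =>
          exact ⟨c, hcst _ ho' c (by simp [ht, Query.substTerm, hz]), (hval z).1 c hz⟩
        | none =>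
          obtain ⟨c, hc, -, hc'⟩ := (hval z).2 hz ⟨o, ho, ht⟩
          have := hc' _ ho' (Query.substTerm_eq_var.2 ⟨ht, hz⟩)
          exact ⟨c, this, hc⟩
    · have : (.cst a : Term ℕ (Const O V T)) ∈ (q.subst ρ).terms := by
        refine .inr (.inr ⟨_, List.mem_map_of_mem hs, ?_⟩)
        rcases h with h | h <;> simp [h, Query.substTerm]
      exact (hterm _ this).2 rfl
    · have := hne _ (List.mem_map_of_mem hs)
      simp only [Query.substTerm_of_not_mem (hneq s hs).1,
        Query.substTerm_of_not_mem (hneq s hs).2] at this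
      rwa [Query.termSet_subst (hneq s hs).1, Query.termSet_subst (hneq s hs).2] at this
    · have hmem : (s.1, s.2.1, s.2.2) ∈ (q.subst ρ).sims := by
        have : _ ∈ (q.subst ρ).sims := List.mem_map_of_mem hs
        simpa only [Query.substTerm_of_not_mem (hsim s hs).1,
          Query.substTerm_of_not_mem (hsim s hs).2] using this
      obtain ⟨c, hc, d, hd, h⟩ := hsi _ hmem
      refine ⟨c, (hterm _ (.inr (.inl ⟨_, hmem, .inl rfl⟩))).2 hc, d,
        (hterm _ (.inr (.inl ⟨_, hmem, .inr rfl⟩))).2 hd, ?_, ?_, h⟩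
      · rwa [Query.termSet_subst (hsim s hs).1] at hc
      · rwa [Query.termSet_subst (hsim s hs).2] at hd
  · rintro ⟨val, g, h, hval⟩
    have hdom : ∀ o ∈ q.occs, g o.k o.i ⊆ D.dom := fun o ho =>
      subset_dom_of_mem_induced hE (h.rels _ _ (Query.mem_occs.1 ho).1) _
    -- the chosen element witnesses that the set of a variable is nonempty
    have hvar : ∀ z, ρ z = none → q.OccursRel z →
        ((q.subst ρ).termSet D.dom g (.var z)).Nonempty ∧
          (q.subst ρ).termSet D.dom g (.var z) ⊆ D.dom := by
      rintro z hz ⟨o, ho, ht⟩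
      refine ⟨?_, fun c hc => hc.1⟩
      obtain ⟨c, hc, he⟩ := h.occs o ho
      rw [Query.termSet_subst (by rintro _ ⟨⟩; exact hz)]
      refine ⟨c, hdom o ho hc, fun o' ho' ht' => ?_⟩
      obtain ⟨c', hc', he'⟩ := h.occs o' ho'
      rw [ht'] at he'
      rw [ht, he'] at he
      cases he
      exact hc'
    have hcst : ∀ a ∈ D.dom, ((q.subst ρ).termSet D.dom g (.cst a)).Nonempty ∧
          (q.subst ρ).termSet D.dom g (.cst a) ⊆ D.dom := by
      rintro a ha
      exact ⟨⟨a, rfl⟩, by rintro _ rfl; exact ha⟩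
    have hocc : ∀ o ∈ q.occs, ∀ a, Query.substTerm ρ o.term = .cst a → a ∈ g o.k o.i := by
      intro o ho a ha
      obtain ⟨c, hc, he⟩ := h.occs o ho
      cases ht : o.term with
      | cst b =>
        rw [ht] at ha he
        cases ha
        cases he
        exact hc
      | var z =>
        rw [ht] at ha he
        cases hz : ρ z with
        | none => simp [Query.substTerm, hz] at ha
        | some b =>
          simp only [Query.substTerm, hz, Term.cst.injEq] at ha
          subst ha
          have := (hval z _ hz).symm.trans he
          cases this
          exact hc
    have hsims : ∀ s ∈ q.sims, ∀ u, (s.2.1 = u ∨ s.2.2 = u) →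
        ((q.subst ρ).termSet D.dom g u).Nonempty ∧ (q.subst ρ).termSet D.dom g u ⊆ D.dom := by
      intro s hs u hu
      cases u with
      | cst a =>
        obtain ⟨c, hc, d, hd, hc', hd', -⟩ := h.sims s hs
        refine hcst a ?_
        rcases hu with hu | hu
        · rw [hu] at hc'; cases hc'; exact hc
        · rw [hu] at hd'; cases hd'; exact hd
      | var z =>
        obtain ⟨o, ho, h, -⟩ := wf.sim_safe s hs z hu
        exact hvar z (hnone z (.inl ⟨s, hs, hu⟩)) ⟨o, ho, h⟩
    refine ⟨g, ?_, ?_, ?_, ?_, ?_⟩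
    · rintro u (⟨o, ho, rfl⟩ | ⟨s, hs, hu⟩ | ⟨s, hs, hu⟩)
      · obtain ⟨o, ho', rfl⟩ := Query.mem_occs_subst.1 ho
        cases ht : Query.substTerm ρ o.term with
        | cst a => exact hcst a (hdom o ho' (hocc o ho' a ht))
        | var z =>
          obtain ⟨ht, hz⟩ := Query.substTerm_eq_var.1 ht
          exact hvar z hz ⟨o, ho', ht⟩
      · obtain ⟨s, hs', rfl⟩ := List.mem_map.1 hs
        simp only [Query.substTerm_of_not_mem (hsim s hs').1,
          Query.substTerm_of_not_mem (hsim s hs').2] at hu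
        exact hsims s hs' u hu
      · obtain ⟨s, hs', rfl⟩ := List.mem_map.1 hs
        simp only [Query.substTerm_of_not_mem (hneq s hs').1,
          Query.substTerm_of_not_mem (hneq s hs').2] at hu
        cases u with
        | cst a => exact hcst a (h.neq_dom s hs' a hu)
        | var z => exact hvar z (hnone z (.inr ⟨s, hs', hu⟩)) (wf.neq_safe s hs' z hu)
    · intro k a ha
      simp only [Query.subst, List.getElem?_map, Option.map_eq_some_iff] at ha
      obtain ⟨a, ha, rfl⟩ := ha
      exact h.rels k a ha
    · intro o ho a ha
      obtain ⟨o, ho', rfl⟩ := Query.mem_occs_subst.1 ho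
      exact hocc o ho' a ha
    · intro s hs
      obtain ⟨s, hs', rfl⟩ := List.mem_map.1 hs
      simp only [Query.substTerm_of_not_mem (hneq s hs').1,
        Query.substTerm_of_not_mem (hneq s hs').2]
      rw [Query.termSet_subst (hneq s hs').1, Query.termSet_subst (hneq s hs').2]
      exact h.neqs s hs'
    · intro s hs
      obtain ⟨s, hs', rfl⟩ := List.mem_map.1 hs
      simp only [Query.substTerm_of_not_mem (hsim s hs').1,
        Query.substTerm_of_not_mem (hsim s hs').2]
      rw [Query.termSet_subst (hsim s hs').1, Query.termSet_subst (hsim s hs').2]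
      obtain ⟨c, -, d, -, hc, hd, h⟩ := h.sims s hs'
      exact ⟨c, hc, d, hd, h⟩

theorem sat_iff (wf : q.WF S) (hE : IsEquivOn E D.objs) :
    Sat sim D E W q ↔ ∃ val g, Witness sim D E W q val g := by
  have := sat_subst_iff (sim := sim) (W := W) wf hE (ρ := fun _ => none) (by simp)
  simpa [Query.subst_none] using this

theorem mem_answers_iff (wf : q.WF S) (hE : IsEquivOn E D.objs) {x y : ℕ}
    (hx : ¬ q.OccursBuiltin x) (hy : ¬ q.OccursBuiltin y) {c d : Const O V T} :
    (c, d) ∈ answers sim D E W q x y ↔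
      ∃ val g, Witness sim D E W q val g ∧ val x = .inl c ∧ val y = .inl d := by
  change (x = y → c = d) ∧ Sat sim D E W (q.inst x y c d) ↔ _
  rw [Query.inst_eq_subst, sat_subst_iff wf hE]
  · constructor
    · rintro ⟨hxy, val, g, h, hval⟩
      refine ⟨val, g, h, hval x c (by simp), ?_⟩
      by_cases hyx : y = x
      · subst hyx
        rw [← hxy rfl]
        exact hval y c (by simp)
      · exact hval y d (by simp [hyx])
    · rintro ⟨val, g, h, hx, hy⟩
      refine ⟨?_, val, g, h, fun z e he => ?_⟩
      · rintro rfl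
        rw [hx] at hy
        exact Sum.inl.inj hy
      · split_ifs at he with h₁ h₂
        · cases he; rw [h₁, hx]
        · cases he; rw [h₂, hy]
  · intro z e he
    split_ifs at he with h₁ h₂
    · rwa [h₁]
    · rwa [h₂]

end Witness

/-! ### Correctness of the translation of queries -/

section Translation

variable {R Q O V T : Type*} {S : Schema R} {sim : Q → V → V → Prop} {D : Database S O V T}
  {E : Set (Const O V T × Const O V T)} {W : Set (Cell T × Cell T)}
  {q : Query R Q (Const O V T)} {σ : PVar → GTerm O V T}

/-- The set at position `i` of the fact to which `σ` maps the `k`-th relational atom of `q`. -/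
def posSet (D : Database S O V T) (E : Set (Const O V T × Const O V T)) (W : Set (Cell T × Cell T))
    (σ : PVar → GTerm O V T) (q : Query R Q (Const O V T)) (k i : ℕ) : Set (Const O V T) :=
  {c | ∃ a f, q.rels[k]? = some a ∧ Fits D σ k a f ∧ c ∈ D.extArgs E W f i}

theorem Fits.unique {σ' : PVar → GTerm O V T} {k : ℕ} {a : RelAtom R (Const O V T)}
    {f f' : Fact R O V T} (h : Fits D σ k a f) (h' : Fits D σ' k a f')
    (ht : (ofTerm a.tid).ground σ = (ofTerm a.tid).ground σ') : f = f' := by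
  refine D.tid_unique f h.mem f' h'.mem ?_
  rw [h.tid, h'.tid] at ht
  simpa using ht

theorem posSet_eq {k : ℕ} {a : RelAtom R (Const O V T)} {f : Fact R O V T}
    (ha : q.rels[k]? = some a) (h : Fits D σ k a f) :
    posSet D E W σ q k = D.extArgs E W f := by
  funext i
  ext c
  constructor
  · rintro ⟨a', f', ha', h', hc⟩
    obtain rfl := Option.some.inj (ha.symm.trans ha')
    rwa [h.unique h' rfl]
  · exact fun hc => ⟨a, f, ha, h, hc⟩

theorem memAtom_allIn_iff_posSet (wf : q.WF S)
    (hrel : AllIn (baseAtoms sim D E W) σ (relAtoms q)) {o : Occ R (Const O V T)}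
    (ho : o ∈ q.occs) {c : PTerm O V T} :
    AllIn (baseAtoms sim D E W) σ (memAtom S o c : List (PAtom R Q O V T)) ↔
      ∃ c', c.ground σ = .inl c' ∧ c' ∈ posSet D E W σ q o.k o.i := by
  have ha := (Query.mem_occs.1 ho).1
  obtain ⟨f, hf⟩ := (relAtoms_allIn_iff wf).1 hrel _ _ ha
  rw [memAtom_allIn_iff wf ho hf, posSet_eq ha hf]

theorem posSet_mem_induced (wf : q.WF S)
    (hrel : AllIn (baseAtoms sim D E W) σ (relAtoms q)) {k : ℕ} {a : RelAtom R (Const O V T)}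
    (ha : q.rels[k]? = some a) : (a.rel, posSet D E W σ q k) ∈ D.induced E W := by
  obtain ⟨f, hf⟩ := (relAtoms_allIn_iff wf).1 hrel _ _ ha
  exact ⟨f, hf.mem, by rw [posSet_eq ha hf, hf.rel]⟩

theorem AllIn.append_iff {P X K : Type*} {B : Set (Atom P K)} {σ : X → K}
    {l l' : List (Atom P (Term X K))} : AllIn B σ (l ++ l') ↔ AllIn B σ l ∧ AllIn B σ l' :=
  List.forall_mem_append

theorem AllIn.flatMap_iff {P X K α : Type*} {B : Set (Atom P K)} {σ : X → K}
    {l : List α} {φ : α → List (Atom P (Term X K))} :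
    AllIn B σ (l.flatMap φ) ↔ ∀ a ∈ l, AllIn B σ (φ a) := by
  simp only [AllIn, List.mem_flatMap]
  exact ⟨fun H a ha b hb => H b ⟨a, ha, hb⟩, fun H b ⟨a, ha, hb⟩ => H a ha b hb⟩

theorem AllIn.nil {P X K : Type*} {B : Set (Atom P K)} {σ : X → K} :
    AllIn B σ ([] : List (Atom P (Term X K))) := by simp [AllIn]

theorem isVar_iff {C : Type*} {x : ℕ} {u : Term ℕ C} : isVar x u = true ↔ u = .var x := by
  cases u with
  | var y => simpa [isVar] using eq_comm
  | cst c => simp [isVar]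

theorem joinAtoms_allIn_iff {B : Set (GAtom R Q O V T)} :
    AllIn B σ (joinAtoms S q) ↔ ∀ o ∈ q.occs, ∀ j, o.i = j + 1 →
      (∀ x, o.term = .var x → isJoin q x → AllIn B σ (memAtom S o (ofTerm o.term))) ∧
      ∀ c, o.term = .cst c → AllIn B σ (memAtom S o (ofTerm o.term)) := by
  rw [joinAtoms, AllIn.flatMap_iff]
  refine forall₂_congr fun o _ => ?_
  cases hi : o.i with
  | zero => simp [AllIn.nil]
  | succ j =>
    cases ht : o.term with
    | cst c => simp [ofTerm]
    | var x => by_cases hx : isJoin q x <;> simp [hx, ofTerm, AllIn.nil]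

theorem simSide_allIn_iff {B : Set (GAtom R Q O V T)} {w : PVar} {u : Term ℕ (Const O V T)} :
    AllIn B σ (simSide S q w u) ↔ ∀ o ∈ q.occs, ∀ x, u = .var x → o.term = .var x →
      S.HasTy o.atom.rel o.i .val → AllIn B σ (memAtom S o (.var w)) := by
  cases u with
  | cst c => simp [simSide, AllIn.nil]
  | var x =>
    rw [simSide, AllIn.flatMap_iff]
    refine forall₂_congr fun o _ => ?_
    have hx : (o.term = .var x) ↔ isVar x o.term = true := isVar_iff.symm
    simp only [Term.var.injEq, forall_eq', hx]
    cases hi : o.i with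
    | zero => simp [AllIn.nil, Schema.HasTy]
    | succ j =>
      cases hv : isVar x o.term with
      | false => simp [AllIn.nil]
      | true =>
        simp only [Schema.HasTy, memAtom, hi, Nat.add_right_cancel_iff, exists_eq_left',
          forall_const]
        rcases hs : (S.ty o.atom.rel)[j]? with _ | ⟨_ | _⟩ <;> simp [AllIn.nil]

theorem simAtoms_allIn_iff {B : Set (GAtom R Q O V T)} :
    AllIn B σ (simAtoms S q) ↔ ∀ n s, q.sims[n]? = some s →
      AllIn B σ (simSide S q (.witL n) s.2.1) ∧ AllIn B σ (simSide S q (.witR n) s.2.2) ∧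
      (⟨.sim s.1, [(simTerm (.witL n) s.2.1).ground σ, (simTerm (.witR n) s.2.2).ground σ]⟩ :
        GAtom R Q O V T) ∈ B := by
  rw [simAtoms, AllIn.flatMap_iff]
  simp only [Prod.forall, List.mem_zipIdx_iff_getElem?, AllIn.append_iff, and_assoc]
  constructor
  · intro H n p u v h
    simpa [AllIn, Atom.ground] using H p u v n h
  · intro H p u v n h
    simpa [AllIn, Atom.ground] using H n p u v h

/-- A variable that is not a join variable has at most one occurrence. -/
theorem eq_of_not_isJoin {x : ℕ} (hx : ¬ isJoin q x) {o o' : Occ R (Const O V T)}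
    (ho : o ∈ q.occs) (ho' : o' ∈ q.occs) (h : o.term = .var x) (h' : o'.term = .var x) :
    o = o' := by
  have hm : o ∈ q.occs.filter fun o => isVar x o.term := by simp [ho, isVar_iff, h]
  have hm' : o' ∈ q.occs.filter fun o => isVar x o.term := by simp [ho', isVar_iff, h']
  simp only [isJoin, decide_eq_true_eq, not_le] at hx
  match hl : q.occs.filter fun o => isVar x o.term with
  | [] => simp [hl] at hm
  | [a] => simp only [hl, List.mem_singleton] at hm hm'; rw [hm, hm']
  | _ :: _ :: _ => simp [hl] at hx

/-- A join variable takes its own value under `σ`. A variable with a single occurrence does not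
appear in the translation, except in tid positions, and takes the entry of the matched fact. -/
theorem exists_val (wf : q.WF S) (hE : IsEquivOn E D.objs) (hW : IsEquivOn W D.cells)
    (hrel : AllIn (baseAtoms sim D E W) σ (relAtoms q))
    (hjoin : AllIn (baseAtoms sim D E W) σ (joinAtoms S q)) :
    ∃ val : ℕ → GTerm O V T,
      (∀ o ∈ q.occs, ∀ x, o.i = 0 → o.term = .var x → val x = σ (.orig x)) ∧
      ∀ o ∈ q.occs, ∃ c ∈ posSet D E W σ q o.k o.i, termValue val o.term = .inl c := by
  have hsingle : ∀ x, ∃ v : GTerm O V T, (isJoin q x → v = σ (.orig x)) ∧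
      (¬ isJoin q x → ∀ o ∈ q.occs, o.term = .var x →
        (o.i = 0 → v = σ (.orig x)) ∧ (o.i ≠ 0 → v = σ (.occ o.k o.i))) := by
    intro x
    by_cases hx : isJoin q x
    · exact ⟨_, fun _ => rfl, fun h => absurd hx h⟩
    · by_cases ho : ∃ o ∈ q.occs, o.term = .var x
      · obtain ⟨o, ho, h⟩ := ho
        refine ⟨if o.i = 0 then σ (.orig x) else σ (.occ o.k o.i), fun h => absurd h hx,
          fun _ o' ho' h' => ?_⟩
        obtain rfl := eq_of_not_isJoin hx ho ho' h h'
        exact ⟨fun hi => by simp [hi], fun hi => by simp [hi]⟩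
      · exact ⟨σ (.orig x), fun _ => rfl, fun _ o ho' h => absurd ⟨o, ho', h⟩ ho⟩
  choose val hval using hsingle
  have hzero : ∀ o ∈ q.occs, ∀ x, o.i = 0 → o.term = .var x → val x = σ (.orig x) := by
    intro o ho x hi hx
    by_cases hj : isJoin q x
    · exact (hval x).1 hj
    · exact ((hval x).2 hj o ho hx).1 hi
  refine ⟨val, hzero, fun o ho => ?_⟩
  obtain ⟨ha, ht⟩ := Query.mem_occs.1 ho
  obtain ⟨f, hf⟩ := (relAtoms_allIn_iff wf).1 hrel _ _ ha
  have hpos : posSet D E W σ q o.k = D.extArgs E W f := posSet_eq ha hf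
  cases hi : o.i with
  | zero =>
    rw [hi] at ht
    have ht' : o.atom.tid = o.term := by simpa using ht
    refine ⟨.tid f.tid, by rw [hpos]; rfl, ?_⟩
    rw [← hf.tid, ht']
    cases hx : o.term with
    | cst c => rfl
    | var x => exact hzero o ho x hi hx
  | succ j =>
    have hmem : AllIn (baseAtoms sim D E W) σ (memAtom S o (ofTerm o.term)) →
        ∃ c ∈ posSet D E W σ q o.k (j + 1), (ofTerm o.term).ground σ = .inl c := by
      intro h
      obtain ⟨c, hc, hc'⟩ := (memAtom_allIn_iff_posSet wf hrel ho).1 h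
      exact ⟨c, hi ▸ hc', hc⟩
    have hj := joinAtoms_allIn_iff.1 hjoin o ho j hi
    cases hx : o.term with
    | cst c =>
      obtain ⟨c', hc', h⟩ := hmem (hj.2 c hx)
      rw [hx] at h
      exact ⟨c', hc', h⟩
    | var x =>
      by_cases hjx : isJoin q x
      · obtain ⟨c', hc', h⟩ := hmem (hj.1 x hx hjx)
        rw [hx] at h
        exact ⟨c', hc', ((hval x).1 hjx).trans h⟩
      · obtain ⟨s, hs⟩ := exists_ty_of_mem_occs wf ho hi
        rw [← hf.rel] at hs
        obtain ⟨c, hc, -⟩ := Database.exists_arg hf.mem hs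
        refine ⟨c, hpos ▸ Database.arg_mem_extArgs hE hW hf.mem hc, ?_⟩
        refine (((hval x).2 hjx o ho hx).2 (by omega)).trans ?_
        rw [hi, hf.arg hc]

/-- A side of a similarity atom: only the occurrences in value positions are translated, which is
enough because a variable with occurrences of both kinds cannot be matched at all. -/
theorem mem_termSet_of_simSide (wf : q.WF S) (hE : IsEquivOn E D.objs) (hW : IsEquivOn W D.cells)
    (hrel : AllIn (baseAtoms sim D E W) σ (relAtoms q)) {val : ℕ → GTerm O V T}
    (hval : ∀ o ∈ q.occs, ∃ c ∈ posSet D E W σ q o.k o.i, termValue val o.term = .inl c)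
    {w : PVar} {u : Term ℕ (Const O V T)}
    (hu : ∀ x, u = .var x → ∃ o ∈ q.occs, o.term = .var x ∧ S.HasTy o.atom.rel o.i .val)
    (hside : AllIn (baseAtoms sim D E W) σ (simSide S q w u)) {c : Const O V T} (hc : c ∈ D.dom)
    (hg : (simTerm w u).ground σ = .inl c) : c ∈ q.termSet D.dom (posSet D E W σ q) u := by
  cases u with
  | cst a => exact (Sum.inl.inj hg).symm
  | var x =>
    refine ⟨hc, fun o ho hx => ?_⟩
    -- the value chosen for `x` is a value, hence all occurrences of `x` are in value positions
    have hsrt : ∀ v, val x = .inl v → v.HasSrt .val := by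
      intro v hv
      obtain ⟨o', ho', hx', j, hi, hs⟩ := hu x rfl
      obtain ⟨d, hd, hd'⟩ := hval o' ho'
      rw [hx'] at hd'
      obtain rfl : v = d := Sum.inl.inj (hv.symm.trans hd')
      obtain ⟨f, hf⟩ := (relAtoms_allIn_iff wf).1 hrel _ _ (Query.mem_occs.1 ho').1
      rw [posSet_eq (Query.mem_occs.1 ho').1 hf, hi] at hd
      exact Database.extArgs_hasSrt hE hW hf.mem (hf.rel ▸ hs) hd
    obtain ⟨d, hd, hd'⟩ := hval o ho
    rw [hx] at hd'
    have hds := hsrt d hd'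
    obtain ⟨f, hf⟩ := (relAtoms_allIn_iff wf).1 hrel _ _ (Query.mem_occs.1 ho).1
    have hpos := posSet_eq (E := E) (W := W) (Query.mem_occs.1 ho).1 hf
    have hty : S.HasTy o.atom.rel o.i .val := by
      cases hi : o.i with
      | zero =>
        rw [hpos, hi] at hd
        obtain rfl : d = .tid f.tid := hd
        exact hds.elim
      | succ j =>
        obtain ⟨s, hs⟩ := exists_ty_of_mem_occs wf ho hi
        cases s with
        | val => exact ⟨j, rfl, hs⟩
        | obj =>
          rw [hpos, hi] at hd
          have := Database.extArgs_hasSrt hE hW hf.mem (hf.rel ▸ hs) hd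
          cases d
          · exact hds.elim
          · exact this.elim
          · exact hds.elim
    obtain ⟨c', hc', h⟩ := (memAtom_allIn_iff_posSet wf hrel ho).1
      (simSide_allIn_iff.1 hside o ho x rfl hx hty)
    have : c = c' := Sum.inl.inj (hg.symm.trans hc')
    rwa [this]

theorem witness_of_allIn (wf : q.WF S) (hE : IsEquivOn E D.objs) (hW : IsEquivOn W D.cells)
    (hneq : q.neqs = []) (h : AllIn (baseAtoms sim D E W) σ (body S q)) :
    ∃ val : ℕ → GTerm O V T, Witness sim D E W q val (posSet D E W σ q) ∧
      ∀ o ∈ q.occs, ∀ x, o.i = 0 → o.term = .var x → val x = σ (.orig x) := by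
  simp only [body, AllIn.append_iff] at h
  obtain ⟨⟨hrel, hjoin⟩, hsim⟩ := h
  obtain ⟨val, hzero, hval⟩ := exists_val wf hE hW hrel hjoin
  refine ⟨val, ⟨fun k a ha => posSet_mem_induced wf hrel ha, hval, by simp [hneq], by simp [hneq],
    fun s hs => ?_⟩, hzero⟩
  obtain ⟨n, hn⟩ := List.mem_iff_getElem?.1 hs
  obtain ⟨hL, hR, hS⟩ := simAtoms_allIn_iff.1 hsim n s hn
  obtain ⟨c, d, hc, hd, hcd, he⟩ := sim_mem_baseAtoms.1 hS
  simp only [List.cons.injEq, and_true] at he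
  exact ⟨c, hc, d, hd,
    mem_termSet_of_simSide wf hE hW hrel hval (fun x hx => wf.sim_safe s hs x (.inl hx)) hL hc he.1,
    mem_termSet_of_simSide wf hE hW hrel hval (fun x hx => wf.sim_safe s hs x (.inr hx)) hR hd he.2,
    hcd⟩

theorem termSet_congr {B : Set (Const O V T)} {g g' : ℕ → ℕ → Set (Const O V T)}
    (h : ∀ k a, q.rels[k]? = some a → g k = g' k) (u : Term ℕ (Const O V T)) :
    q.termSet B g u = q.termSet B g' u := by
  cases u with
  | cst a => rfl
  | var x =>
    ext c
    simp only [Query.termSet, Set.mem_ofPred_eq]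
    refine and_congr_right fun _ => forall₂_congr fun o ho => ?_
    rw [h _ _ (Query.mem_occs.1 ho).1]

theorem Witness.exists_subst (wf : q.WF S) {val : ℕ → GTerm O V T}
    {g : ℕ → ℕ → Set (Const O V T)} (h : Witness sim D E W q val g) :
    ∃ σ : PVar → GTerm O V T, (∀ x, σ (.orig x) = val x) ∧
      AllIn (baseAtoms sim D E W) σ (body S q) ∧
      (∀ k a, q.rels[k]? = some a → g k = posSet D E W σ q k) := by
  have hfact : ∀ k, ∃ φ : ℕ → GTerm O V T, ∀ a, q.rels[k]? = some a → ∃ f ∈ D.facts,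
      f.rel = a.rel ∧ g k = D.extArgs E W f ∧ ∀ j c, f.args[j]? = some c → φ (j + 1) = .inl c := by
    intro k
    cases ha : q.rels[k]? with
    | none => exact ⟨fun _ => .inr 0, by simp⟩
    | some a =>
      obtain ⟨f, hf, he⟩ := h.rels k a ha
      simp only [Prod.mk.injEq] at he
      refine ⟨fun i => (f.args[i - 1]?).elim (.inr 0) .inl, ?_⟩
      rintro _ ⟨⟩
      exact ⟨f, hf, he.1.symm, he.2, fun j c hj => by simp [hj]⟩
  have hwit : ∀ n : ℕ, ∃ p : GTerm O V T × GTerm O V T, ∀ s, q.sims[n]? = some s →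
      ∃ c ∈ D.dom, ∃ d ∈ D.dom, c ∈ q.termSet D.dom g s.2.1 ∧ d ∈ q.termSet D.dom g s.2.2 ∧
        SimConst sim s.1 c d ∧ p = (.inl c, .inl d) := by
    intro n
    cases hs : q.sims[n]? with
    | none => exact ⟨(.inr 0, .inr 0), by simp⟩
    | some s =>
      obtain ⟨c, hc, d, hd, h₁, h₂, h₃⟩ := h.sims s (List.mem_of_getElem? hs)
      refine ⟨(.inl c, .inl d), ?_⟩
      rintro _ ⟨⟩
      exact ⟨c, hc, d, hd, h₁, h₂, h₃, rfl⟩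
  choose φ hφ using hfact
  choose p hp using hwit
  let σ : PVar → GTerm O V T
    | .orig x => val x
    | .occ k i => φ k i
    | .witL n => (p n).1
    | .witR n => (p n).2
    | .aux _ => .inr 0
  have hev : ∀ u, (ofTerm u).ground σ = termValue val u := ground_ofTerm
  have hfits : ∀ k a, q.rels[k]? = some a → ∃ f, Fits D σ k a f ∧ g k = D.extArgs E W f := by
    intro k a ha
    obtain ⟨f, hf, hr, hg, harg⟩ := hφ k a ha
    refine ⟨f, ⟨hf, hr, ?_, fun hj => harg _ _ hj⟩, hg⟩
    obtain ⟨c, hc, he⟩ := h.occs ⟨k, 0, a, a.tid⟩ (Query.mem_occs.2 ⟨ha, rfl⟩)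
    simp only [hg] at hc
    obtain rfl : c = .tid f.tid := hc
    exact (hev _).trans he
  have hrel : AllIn (baseAtoms sim D E W) σ (relAtoms q) :=
    (relAtoms_allIn_iff wf).2 fun k a ha => (hfits k a ha).imp fun _ h => h.1
  have hpos : ∀ k a, q.rels[k]? = some a → g k = posSet D E W σ q k := by
    intro k a ha
    obtain ⟨f, hf, hg⟩ := hfits k a ha
    rw [hg, posSet_eq ha hf]
  have hmem : ∀ o ∈ q.occs, AllIn (baseAtoms sim D E W) σ (memAtom S o (ofTerm o.term)) := by
    intro o ho
    obtain ⟨c, hc, he⟩ := h.occs o ho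
    exact (memAtom_allIn_iff_posSet wf hrel ho).2
      ⟨c, (hev _).trans he, hpos _ _ (Query.mem_occs.1 ho).1 ▸ hc⟩
  -- a side of a similarity atom
  have hside : ∀ (w : PVar) (u : Term ℕ (Const O V T)) (c : Const O V T), σ w = .inl c →
      c ∈ q.termSet D.dom g u → AllIn (baseAtoms sim D E W) σ (simSide S q w u) ∧
        (simTerm w u).ground σ = .inl c := by
    intro w u c hw hc
    refine ⟨simSide_allIn_iff.2 ?_, ?_⟩
    · rintro o ho x rfl hx -
      exact (memAtom_allIn_iff_posSet wf hrel ho).2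
        ⟨c, hw, hpos _ _ (Query.mem_occs.1 ho).1 ▸ hc.2 o ho hx⟩
    · cases u with
      | cst a => cases hc; rfl
      | var x => exact hw
  refine ⟨σ, fun _ => rfl, ?_, hpos⟩
  simp only [body, AllIn.append_iff]
  refine ⟨⟨hrel, joinAtoms_allIn_iff.2 fun o ho _ _ =>
    ⟨fun _ _ _ => hmem o ho, fun _ _ => hmem o ho⟩⟩, simAtoms_allIn_iff.2 fun n s hs => ?_⟩
  obtain ⟨c, hc, d, hd, h₁, h₂, h₃, he⟩ := hp n s hs
  obtain ⟨hL, hL'⟩ := hside (.witL n) s.2.1 c (by simp [σ, he]) h₁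
  obtain ⟨hR, hR'⟩ := hside (.witR n) s.2.2 d (by simp [σ, he]) h₂
  exact ⟨hL, hR, sim_mem_baseAtoms.2 ⟨c, d, hc, hd, h₃, by rw [hL', hR']⟩⟩

end Translation

/-! ### Correctness of the translation of rules and denial constraints -/

section Rules

variable {R Q O V T : Type*} {S : Schema R} {sim : Q → V → V → Prop} {D : Database S O V T}
  {E : Set (Const O V T × Const O V T)} {W : Set (Cell T × Cell T)}
  {q : Query R Q (Const O V T)} {σ : PVar → GTerm O V T}

/-- The value chosen for an object variable is equivalent to the entry of the matched fact at the
first occurrence of the variable, which is what the head of the translated rule refers to. -/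
theorem pick_equiv (wf : q.WF S) (hrel : AllIn (baseAtoms sim D E W) σ (relAtoms q))
    {val : ℕ → GTerm O V T}
    (hval : ∀ o ∈ q.occs, ∃ c ∈ posSet D E W σ q o.k o.i, termValue val o.term = .inl c)
    {x : ℕ} (hx : IsObjVar S q x) :
    ∃ c c', val x = .inl c ∧ (pick q x).ground σ = .inl c' ∧ (c', c) ∈ E := by
  obtain ⟨⟨o₀, ho₀, hx₀⟩, hobj, -⟩ := hx
  cases hfind : q.occs.find? fun o => isVar x o.term with
  | none =>
    have := List.find?_eq_none.1 hfind o₀ ho₀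
    exact absurd (isVar_iff.2 hx₀) this
  | some o =>
    have ho := List.mem_of_find?_eq_some hfind
    have hox : o.term = .var x := isVar_iff.1 (by simpa using List.find?_some hfind)
    obtain ⟨c, hc, he⟩ := hval o ho
    obtain ⟨j, hi, hs⟩ := hobj o ho hox
    obtain ⟨f, hf⟩ := (relAtoms_allIn_iff wf).1 hrel _ _ (Query.mem_occs.1 ho).1
    rw [posSet_eq (Query.mem_occs.1 ho).1 hf, hi] at hc
    obtain ⟨b, hb, H⟩ := Database.mem_extArgs_obj (E := E) (W := W) hf.mem (hf.rel ▸ hs)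
    rw [hox] at he
    refine ⟨c, .obj b, he, ?_, (H c).1 hc⟩
    simp only [pick, hfind, ground_var, hi, hf.arg hb]

theorem tidVar_cell (wf : q.WF S) (hrel : AllIn (baseAtoms sim D E W) σ (relAtoms q))
    {val : ℕ → GTerm O V T}
    (hval : ∀ o ∈ q.occs, ∃ c ∈ posSet D E W σ q o.k o.i, termValue val o.term = .inl c)
    {x i : ℕ} (hx : IsTidVar S q x i) : ∃ t, val x = .inl (.tid t) ∧ (t, i) ∈ D.cells := by
  obtain ⟨⟨k, a, ha, hax, hty, -⟩, -⟩ := hx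
  obtain ⟨f, hf⟩ := (relAtoms_allIn_iff wf).1 hrel _ _ ha
  obtain ⟨c, hc, he⟩ := hval ⟨k, 0, a, a.tid⟩ (Query.mem_occs.2 ⟨ha, rfl⟩)
  simp only [posSet_eq ha hf, hax] at hc he
  obtain rfl : c = .tid f.tid := hc
  exact ⟨f.tid, he, f, hf.mem, rfl, hf.rel ▸ hty⟩

theorem Witness.posSet {val : ℕ → GTerm O V T} {g : ℕ → ℕ → Set (Const O V T)}
    (h : Witness sim D E W q val g)
    (hg : ∀ k a, q.rels[k]? = some a → g k = posSet D E W σ q k) :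
    ∀ o ∈ q.occs, ∃ c ∈ posSet D E W σ q o.k o.i, termValue val o.term = .inl c := by
  intro o ho
  rw [← hg _ _ (Query.mem_occs.1 ho).1]
  exact h.occs o ho

theorem body_rel {B : Set (GAtom R Q O V T)} (h : AllIn B σ (body S q)) :
    AllIn B σ (relAtoms q) := by
  simp only [body, AllIn.append_iff] at h
  exact h.1.1

/-- The pairs derived by the translated body of a rule for objects are, up to `E`, answers. -/
theorem ObjRule.answer_of_body (r : ObjRule S Q O V T) (hE : IsEquivOn E D.objs)
    (hW : IsEquivOn W D.cells) (h : AllIn (baseAtoms sim D E W) σ (body S r.q)) :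
    ∃ c d c' d', (c, d) ∈ answers sim D E W r.q r.x r.y ∧ (pick r.q r.x).ground σ = .inl c' ∧
      (pick r.q r.y).ground σ = .inl d' ∧ (c', c) ∈ E ∧ (d', d) ∈ E := by
  obtain ⟨val, hw, -⟩ := witness_of_allIn r.wf hE hW r.no_neq h
  obtain ⟨c, c', hc, hc', hcE⟩ := pick_equiv r.wf (body_rel h) hw.occs r.hx
  obtain ⟨d, d', hd, hd', hdE⟩ := pick_equiv r.wf (body_rel h) hw.occs r.hy
  exact ⟨c, d, c', d', (mem_answers_iff r.wf hE r.hx.2.2 r.hy.2.2).2 ⟨val, _, hw, hc, hd⟩,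
    hc', hd', hcE, hdE⟩

/-- Every answer to the body of a rule for objects is, up to `E`, derived by its translation. -/
theorem ObjRule.body_of_answer (r : ObjRule S Q O V T) (hE : IsEquivOn E D.objs)
    {c d : Const O V T} (h : (c, d) ∈ answers sim D E W r.q r.x r.y) :
    ∃ (σ : PVar → GTerm O V T) (c' d' : Const O V T),
      AllIn (baseAtoms sim D E W) σ (body S r.q) ∧ (pick r.q r.x).ground σ = .inl c' ∧
      (pick r.q r.y).ground σ = .inl d' ∧ (c', c) ∈ E ∧ (d', d) ∈ E := by
  obtain ⟨val, g, hw, hx, hy⟩ := (mem_answers_iff r.wf hE r.hx.2.2 r.hy.2.2).1 h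
  obtain ⟨σ, -, hb, hg⟩ := hw.exists_subst r.wf
  obtain ⟨c₁, c', hc, hc', hcE⟩ := pick_equiv r.wf (body_rel hb) (hw.posSet hg) r.hx
  obtain ⟨d₁, d', hd, hd', hdE⟩ := pick_equiv r.wf (body_rel hb) (hw.posSet hg) r.hy
  obtain rfl : c = c₁ := Sum.inl.inj (hx.symm.trans hc)
  obtain rfl : d = d₁ := Sum.inl.inj (hy.symm.trans hd)
  exact ⟨σ, c', d', hb, hc', hd', hcE, hdE⟩

theorem ValRule.answer_of_body (r : ValRule S Q O V T) (hE : IsEquivOn E D.objs)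
    (hW : IsEquivOn W D.cells) (h : AllIn (baseAtoms sim D E W) σ (body S r.q)) :
    ∃ t t', (.tid t, .tid t') ∈ answers sim D E W r.q r.x r.y ∧ σ (.orig r.x) = .inl (.tid t) ∧
      σ (.orig r.y) = .inl (.tid t') ∧ (t, r.i) ∈ D.cells ∧ (t', r.j) ∈ D.cells := by
  obtain ⟨val, hw, hzero⟩ := witness_of_allIn r.wf hE hW r.no_neq h
  obtain ⟨t, ht, htc⟩ := tidVar_cell r.wf (body_rel h) hw.occs r.hx
  obtain ⟨t', ht', htc'⟩ := tidVar_cell r.wf (body_rel h) hw.occs r.hy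
  have hσ : ∀ x i, IsTidVar S r.q x i → val x = σ (.orig x) := by
    rintro x i ⟨⟨k, a, ha, hax, -⟩, -⟩
    exact hzero ⟨k, 0, a, a.tid⟩ (Query.mem_occs.2 ⟨ha, rfl⟩) x rfl hax
  exact ⟨t, t', (mem_answers_iff r.wf hE r.hx.2 r.hy.2).2 ⟨val, _, hw, ht, ht'⟩,
    (hσ _ _ r.hx).symm.trans ht, (hσ _ _ r.hy).symm.trans ht', htc, htc'⟩

theorem ValRule.body_of_answer (r : ValRule S Q O V T) (hE : IsEquivOn E D.objs)
    {t t' : T} (h : (.tid t, .tid t') ∈ answers sim D E W r.q r.x r.y) :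
    ∃ σ : PVar → GTerm O V T, AllIn (baseAtoms sim D E W) σ (body S r.q) ∧
      σ (.orig r.x) = .inl (.tid t) ∧ σ (.orig r.y) = .inl (.tid t') ∧
      (t, r.i) ∈ D.cells ∧ (t', r.j) ∈ D.cells := by
  obtain ⟨val, g, hw, hx, hy⟩ := (mem_answers_iff r.wf hE r.hx.2 r.hy.2).1 h
  obtain ⟨σ, hσ, hb, hg⟩ := hw.exists_subst r.wf
  obtain ⟨t₁, ht, htc⟩ := tidVar_cell r.wf (body_rel hb) (hw.posSet hg) r.hx
  obtain ⟨t₁', ht', htc'⟩ := tidVar_cell r.wf (body_rel hb) (hw.posSet hg) r.hy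
  rw [hx] at ht
  rw [hy] at ht'
  cases ht
  cases ht'
  exact ⟨σ, hb, (hσ _).trans hx, (hσ _).trans hy, htc, htc'⟩

theorem IsCandidate.isEquivOn {Sp : Spec S Q O V T} (h : IsCandidate sim D Sp E W) :
    IsEquivOn E D.objs ∧ IsEquivOn W D.cells := by
  induction h with
  | init => exact ⟨isEquivOn_eqRel (Set.empty_subset _), isEquivOn_eqRel (Set.empty_subset _)⟩
  | mergeO r o o' _ _ hans ih =>
    obtain ⟨σ, c', d', -, -, -, hc, hd⟩ := r.body_of_answer ih.1 hans
    refine ⟨isEquivOn_eqRel (Set.union_subset ih.1.subset_prod ?_), ih.2⟩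
    rintro _ rfl
    exact ⟨ih.1.right_mem hc, ih.1.right_mem hd⟩
  | mergeV r t t' _ _ hans ih =>
    obtain ⟨σ, -, -, -, hc, hd⟩ := r.body_of_answer ih.1 hans
    refine ⟨ih.1, isEquivOn_eqRel (Set.union_subset ih.2.subset_prod ?_)⟩
    rintro _ rfl
    exact ⟨hc, hd⟩

theorem memTerm_allIn_iff (wf : q.WF S) (hE : IsEquivOn E D.objs)
    (hrel : AllIn (baseAtoms sim D E W) σ (relAtoms q)) {u : Term ℕ (Const O V T)}
    (hu : ∀ x, u = .var x → q.OccursRel x) {t : PTerm O V T} :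
    AllIn (baseAtoms sim D E W) σ (memTerm S q t u) ↔
      ∃ c ∈ D.dom, t.ground σ = .inl c ∧ c ∈ q.termSet D.dom (posSet D E W σ q) u := by
  cases u with
  | cst a =>
    simp only [memTerm, AllIn, List.forall_mem_singleton, Atom.ground, List.map_cons,
      List.map_nil, same_mem_baseAtoms, List.cons.injEq, and_true, ground_cst, Sum.inl.injEq]
    constructor
    · rintro ⟨c, hc, h, rfl⟩
      exact ⟨a, hc, h, rfl⟩
    · rintro ⟨c, hc, h, hca⟩
      obtain rfl : c = a := hca
      exact ⟨c, hc, h, rfl⟩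
  | var x =>
    simp only [memTerm, AllIn.flatMap_iff, List.mem_filter, isVar_iff]
    constructor
    · intro H
      obtain ⟨o, ho, hx⟩ := hu x rfl
      obtain ⟨c, hc, hc'⟩ := (memAtom_allIn_iff_posSet wf hrel ho).1 (H o ⟨ho, hx⟩)
      have hdom : c ∈ D.dom :=
        subset_dom_of_mem_induced hE (posSet_mem_induced wf hrel (Query.mem_occs.1 ho).1) _ hc'
      refine ⟨c, hdom, hc, hdom, fun o' ho' hx' => ?_⟩
      obtain ⟨c', h, h'⟩ := (memAtom_allIn_iff_posSet wf hrel ho').1 (H o' ⟨ho', hx'⟩)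
      rw [hc] at h
      cases h
      exact h'
    · rintro ⟨c, -, hc, -, H⟩ o ⟨ho, hx⟩
      exact (memAtom_allIn_iff_posSet wf hrel ho).2 ⟨c, hc, H o ho hx⟩

theorem neqGuard_allIn_iff {B : Set (GAtom R Q O V T)} :
    AllIn B σ (neqGuard q) ↔ ∀ s ∈ q.neqs, ∀ a, s.1 = .cst a ∨ s.2 = .cst a →
      (⟨.same, [.inl a, .inl a]⟩ : GAtom R Q O V T) ∈ B := by
  rw [neqGuard, AllIn.flatMap_iff]
  refine forall₂_congr fun s _ => ?_
  obtain ⟨u, v⟩ := s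
  rw [AllIn.flatMap_iff]
  cases u <;> cases v <;>
    simp [AllIn, Atom.ground, ground_cst, or_imp, forall_and]

/-- The atoms which derive that the `j`-th inequality is violated hold for some substitution with
the same tids as `σ` exactly if the two sides have a common element: the tids of the relational
atoms determine the facts to which these are mapped. -/
theorem common_iff (wf : q.WF S) (hE : IsEquivOn E D.objs)
    (hrel : AllIn (baseAtoms sim D E W) σ (relAtoms q)) {j : ℕ}
    {s : Term ℕ (Const O V T) × Term ℕ (Const O V T)} (hs : s ∈ q.neqs)
    (hdom : ∀ a, s.1 = .cst a ∨ s.2 = .cst a → a ∈ D.dom) :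
    (∃ σ' : PVar → GTerm O V T, (commonAtom q j : PAtom R Q O V T).ground σ' =
        (commonAtom q j : PAtom R Q O V T).ground σ ∧ AllIn (baseAtoms sim D E W) σ'
          (relAtoms q ++ memTerm S q (auxT 0) s.1 ++ memTerm S q (auxT 0) s.2)) ↔
      (q.termSet D.dom (posSet D E W σ q) s.1 ∩
        q.termSet D.dom (posSet D E W σ q) s.2).Nonempty := by
  have hsafe₁ : ∀ x, s.1 = .var x → q.OccursRel x := fun x h => wf.neq_safe s hs x (.inl h)
  have hsafe₂ : ∀ x, s.2 = .var x → q.OccursRel x := fun x h => wf.neq_safe s hs x (.inr h)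
  simp only [AllIn.append_iff]
  constructor
  · rintro ⟨σ', htid, ⟨hrel', h₁⟩, h₂⟩
    have hpos : ∀ k a, q.rels[k]? = some a → posSet D E W σ' q k = posSet D E W σ q k := by
      intro k a ha
      obtain ⟨f, hf⟩ := (relAtoms_allIn_iff wf).1 hrel k a ha
      obtain ⟨f', hf'⟩ := (relAtoms_allIn_iff wf).1 hrel' k a ha
      have ht := congrArg (fun b : GAtom R Q O V T => b.args[k]?) htid
      simp only [Atom.ground, commonAtom, List.map_map, List.getElem?_map, ha, Option.map_some,
        Function.comp_apply, Option.some.injEq] at ht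
      rw [posSet_eq ha hf, posSet_eq ha hf', hf'.unique hf ht]
    obtain ⟨c, -, hc, hc₁⟩ := (memTerm_allIn_iff wf hE hrel' hsafe₁).1 h₁
    obtain ⟨c', -, hc', hc₂⟩ := (memTerm_allIn_iff wf hE hrel' hsafe₂).1 h₂
    obtain rfl : c = c' := Sum.inl.inj (hc.symm.trans hc')
    rw [termSet_congr hpos] at hc₁ hc₂
    exact ⟨c, hc₁, hc₂⟩
  · rintro ⟨c, hc₁, hc₂⟩
    have hc : c ∈ D.dom := by
      cases hu : s.1 with
      | cst a => rw [hu] at hc₁; cases hc₁; exact hdom c (.inl hu)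
      | var x => rw [hu] at hc₁; exact hc₁.1
    classical
    let σ' := Function.update σ (.aux 0) (.inl c)
    have hterm : ∀ u : Term ℕ (Const O V T), (ofTerm u).ground σ' = (ofTerm u).ground σ := by
      intro u
      simp [ground_ofTerm, σ']
    have hfits : ∀ k a, q.rels[k]? = some a → ∃ f, Fits D σ k a f ∧ Fits D σ' k a f := by
      intro k a ha
      obtain ⟨f, hf⟩ := (relAtoms_allIn_iff wf).1 hrel k a ha
      exact ⟨f, hf, hf.mem, hf.rel, (hterm _).trans hf.tid, fun hj => by simp [σ', hf.arg hj]⟩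
    have hrel' : AllIn (baseAtoms sim D E W) σ' (relAtoms q) :=
      (relAtoms_allIn_iff wf).2 fun k a ha => (hfits k a ha).imp fun _ h => h.2
    have hpos : ∀ k a, q.rels[k]? = some a → posSet D E W σ q k = posSet D E W σ' q k := by
      intro k a ha
      obtain ⟨f, hf, hf'⟩ := hfits k a ha
      rw [posSet_eq ha hf, posSet_eq ha hf']
    have haux : (auxT 0 : PTerm O V T).ground σ' = .inl c := by simp [auxT, ground_var, σ']
    rw [termSet_congr hpos] at hc₁ hc₂
    refine ⟨σ', ?_, ⟨hrel', (memTerm_allIn_iff wf hE hrel' hsafe₁).2 ⟨c, hc, haux, hc₁⟩⟩,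
      (memTerm_allIn_iff wf hE hrel' hsafe₂).2 ⟨c, hc, haux, hc₂⟩⟩
    simp [Atom.ground, commonAtom, hterm]

theorem Denial.sat_iff (d : Denial S Q O V T) (hE : IsEquivOn E D.objs)
    (hW : IsEquivOn W D.cells) :
    Sat sim D E W d.q ↔ ∃ σ : PVar → GTerm O V T,
      AllIn (baseAtoms sim D E W) σ (relAtoms d.q ++ joinAtoms S d.q ++ neqGuard d.q) ∧
      ∀ j s, d.q.neqs[j]? = some s → ¬ ∃ σ' : PVar → GTerm O V T,
        (commonAtom d.q j : PAtom R Q O V T).ground σ' =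
          (commonAtom d.q j : PAtom R Q O V T).ground σ ∧ AllIn (baseAtoms sim D E W) σ'
          (relAtoms d.q ++ memTerm S d.q (auxT 0) s.1 ++ memTerm S d.q (auxT 0) s.2) := by
  rw [Lace.sat_iff d.wf hE]
  constructor
  · rintro ⟨val, g, h⟩
    obtain ⟨σ, -, hb, hg⟩ := h.exists_subst d.wf
    simp only [body, AllIn.append_iff] at hb
    refine ⟨σ, ?_, fun j s hs => ?_⟩
    · simp only [AllIn.append_iff]
      exact ⟨hb.1, neqGuard_allIn_iff.2 fun s hs a ha =>
        same_mem_baseAtoms.2 ⟨a, h.neq_dom s hs a ha, rfl⟩⟩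
    · have hs := List.mem_of_getElem? hs
      rw [common_iff d.wf hE hb.1.1 hs (h.neq_dom s hs), Set.not_nonempty_iff_eq_empty,
        ← termSet_congr hg, ← termSet_congr hg]
      exact h.neqs s hs
  · rintro ⟨σ, h, hne⟩
    simp only [AllIn.append_iff] at h
    obtain ⟨⟨hrel, hjoin⟩, hguard⟩ := h
    obtain ⟨val, -, hval⟩ := exists_val d.wf hE hW hrel hjoin
    have hdom : ∀ s ∈ d.q.neqs, ∀ a, s.1 = .cst a ∨ s.2 = .cst a → a ∈ D.dom := by
      intro s hs a ha
      obtain ⟨c, hc, he⟩ := same_mem_baseAtoms.1 (neqGuard_allIn_iff.1 hguard s hs a ha)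
      cases he
      exact hc
    refine ⟨val, _, fun k a ha => posSet_mem_induced d.wf hrel ha, hval, hdom, fun s hs => ?_,
      by simp [d.no_sim]⟩
    obtain ⟨j, hj⟩ := List.mem_iff_getElem?.1 hs
    have := hne j s hj
    rwa [common_iff d.wf hE hrel hs (hdom s hs), Set.not_nonempty_iff_eq_empty] at this

end Rules

/-! ### Models of the program -/

section Closure

variable {R Q O V T : Type*} {S : Schema R} {sim : Q → V → V → Prop} {D : Database S O V T}
  {E : Set (Const O V T × Const O V T)} {W : Set (Cell T × Cell T)}

/-- `N` satisfies all ground instances of a rule in the reduct relative to `M`. -/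
def RuleHolds {P X K : Type*} (M N : Set (Atom P K)) (r : Rule P X K) : Prop :=
  ∀ σ : X → K, (∀ b ∈ r.neg, b.ground σ ∉ M) → AllIn N σ r.pos →
    ∃ h, r.head = some h ∧ h.ground σ ∈ N

/-- Closure under the rules that do not depend on the schema and the specification, spelled out
for ground terms. -/
structure GenericClosed (M N : Set (GAtom R Q O V T)) : Prop where
  val : ∀ a b c d e, ⟨.eqV, [a, b, d, e]⟩ ∈ N → ⟨.proj, [d, e, c]⟩ ∈ N → ⟨.val, [a, b, c]⟩ ∈ N
  same_tid : ∀ a, ⟨.tid, [a]⟩ ∈ N → ⟨.same, [a, a]⟩ ∈ N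
  same_proj : ∀ a b c, ⟨.proj, [b, c, a]⟩ ∈ N → ⟨.same, [a, a]⟩ ∈ N
  reflO : ∀ a, ⟨.obj, [a]⟩ ∈ N → ⟨.eqO, [a, a]⟩ ∈ N
  symmO : ∀ a b, ⟨.eqO, [b, a]⟩ ∈ N → ⟨.eqO, [a, b]⟩ ∈ N
  transO : ∀ a b c, ⟨.eqO, [a, b]⟩ ∈ N → ⟨.eqO, [b, c]⟩ ∈ N → ⟨.eqO, [a, c]⟩ ∈ N
  reflV : ∀ a b, ⟨.tid, [a]⟩ ∈ N → ⟨.valpos, [a, b]⟩ ∈ N → ⟨.eqV, [a, b, a, b]⟩ ∈ N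
  symmV : ∀ a b c d, ⟨.eqV, [c, d, a, b]⟩ ∈ N → ⟨.eqV, [a, b, c, d]⟩ ∈ N
  transV : ∀ a b c d e f, ⟨.eqV, [a, b, c, d]⟩ ∈ N → ⟨.eqV, [c, d, e, f]⟩ ∈ N →
    ⟨.eqV, [a, b, e, f]⟩ ∈ N
  eqO : ∀ a b, ⟨.neqO, [a, b]⟩ ∉ M → ⟨.activeO, [a, b]⟩ ∈ N → ⟨.eqO, [a, b]⟩ ∈ N
  neqO : ∀ a b, ⟨.eqO, [a, b]⟩ ∉ M → ⟨.activeO, [a, b]⟩ ∈ N → ⟨.neqO, [a, b]⟩ ∈ N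
  eqV : ∀ a b c d, ⟨.neqV, [a, b, c, d]⟩ ∉ M → ⟨.activeV, [a, b, c, d]⟩ ∈ N →
    ⟨.eqV, [a, b, c, d]⟩ ∈ N
  neqV : ∀ a b c d, ⟨.eqV, [a, b, c, d]⟩ ∉ M → ⟨.activeV, [a, b, c, d]⟩ ∈ N →
    ⟨.neqV, [a, b, c, d]⟩ ∈ N

theorem genericRules_iff {M N : Set (GAtom R Q O V T)} :
    (∀ r ∈ (genericRules : List (PRule R Q O V T)), RuleHolds M N r) ↔ GenericClosed M N := by
  simp only [genericRules, List.forall_mem_cons, RuleHolds, AllIn, Atom.ground, List.map_cons,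
    List.map_nil, Option.some.injEq, exists_eq_left', List.not_mem_nil, IsEmpty.forall_iff,
    implies_true, auxT, ground_var, forall_const, and_true]
  constructor
  · rintro ⟨h₁, h₂, h₃, h₄, h₅, h₆, h₇, h₈, h₉, h₁₀, h₁₁, h₁₂, h₁₃⟩
    let σ (l : List (GTerm O V T)) : PVar → GTerm O V T
      | .aux n => l.getD n (.inr 0)
      | _ => .inr 0
    exact
      { val := fun a b c d e h h' => h₁ (σ [a, b, c, d, e]) ⟨h, h'⟩
        same_tid := fun a h => h₂ (σ [a]) h
        same_proj := fun a b c h => h₃ (σ [a, b, c]) h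
        reflO := fun a h => h₄ (σ [a]) h
        symmO := fun a b h => h₅ (σ [a, b]) h
        transO := fun a b c h h' => h₆ (σ [a, b, c]) ⟨h, h'⟩
        reflV := fun a b h h' => h₇ (σ [a, b]) ⟨h, h'⟩
        symmV := fun a b c d h => h₈ (σ [a, b, c, d]) h
        transV := fun a b c d e f h h' => h₉ (σ [a, b, c, d, e, f]) ⟨h, h'⟩
        eqO := fun a b h h' => h₁₀ (σ [a, b]) h h'
        neqO := fun a b h h' => h₁₁ (σ [a, b]) h h'
        eqV := fun a b c d h h' => h₁₂ (σ [a, b, c, d]) h h'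
        neqV := fun a b c d h h' => h₁₃ (σ [a, b, c, d]) h h' }
  · intro H
    exact ⟨fun σ h => H.val _ _ _ _ _ h.1 h.2, fun σ h => H.same_tid _ h,
      fun σ h => H.same_proj _ _ _ h, fun σ h => H.reflO _ h, fun σ h => H.symmO _ _ h,
      fun σ h => H.transO _ _ _ h.1 h.2, fun σ h => H.reflV _ _ h.1 h.2,
      fun σ h => H.symmV _ _ _ _ h, fun σ h => H.transV _ _ _ _ _ _ h.1 h.2,
      fun σ h h' => H.eqO _ _ h h', fun σ h h' => H.neqO _ _ h h',
      fun σ h h' => H.eqV _ _ _ _ h h', fun σ h h' => H.neqV _ _ _ _ h h'⟩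

theorem relRules_iff {M N : Set (GAtom R Q O V T)} {r : R} :
    (∀ ρ ∈ (relRules S r : List (PRule R Q O V T)), RuleHolds M N ρ) ↔
      ∀ σ : PVar → GTerm O V T, (freshAtom r (.var (.occ 0 0)) 0 (S.ty r).length :
          PAtom R Q O V T).ground σ ∈ N →
        ⟨.tid, [σ (.occ 0 0)]⟩ ∈ N ∧ ∀ j s, (S.ty r)[j]? = some s →
          ⟨.proj, [σ (.occ 0 0), .inr (j + 1), σ (.occ 0 (j + 1))]⟩ ∈ N ∧
          (s = .obj → ⟨.obj, [σ (.occ 0 (j + 1))]⟩ ∈ N) ∧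
          (s = .val → ⟨.valpos, [σ (.occ 0 0), .inr (j + 1)]⟩ ∈ N) := by
  have hsingle : ∀ (b h : PAtom R Q O V T),
      RuleHolds M N ({ head := some h, pos := [b] } : PRule R Q O V T) ↔
        ∀ σ, b.ground σ ∈ N → h.ground σ ∈ N := by
    intro b h
    simp [RuleHolds, AllIn]
  simp only [relRules, List.forall_mem_cons, List.forall_mem_flatMap, hsingle]
  constructor
  · rintro ⟨h, H⟩ σ hσ
    refine ⟨h σ hσ, fun j s hs => ?_⟩
    obtain ⟨h₁, h₂⟩ := H (s, j) (List.mem_zipIdx_iff_getElem?.2 hs)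
    refine ⟨h₁ σ hσ, ?_, ?_⟩
    · rintro rfl
      exact (hsingle _ _).1 (h₂ _ (List.mem_singleton_self _)) σ hσ
    · rintro rfl
      exact (hsingle _ _).1 (h₂ _ (List.mem_singleton_self _)) σ hσ
  · intro H
    refine ⟨fun σ hσ => (H σ hσ).1, ?_⟩
    rintro ⟨s, j⟩ hs
    have hs := List.mem_zipIdx_iff_getElem?.1 hs
    refine ⟨fun σ hσ => ((H σ hσ).2 j s hs).1, ?_⟩
    cases s with
    | obj =>
      simp only [List.forall_mem_singleton, hsingle]
      exact fun σ hσ => ((H σ hσ).2 j _ hs).2.1 rfl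
    | val =>
      simp only [List.forall_mem_singleton, hsingle]
      exact fun σ hσ => ((H σ hσ).2 j _ hs).2.2 rfl

theorem isModelOfReduct_iff [Fintype R] {Sp : Spec S Q O V T} {F M N : Set (GAtom R Q O V T)} :
    IsModelOfReduct (piSol Sp) F M N ↔ F ⊆ N ∧
      (∀ r ∈ (genericRules : List (PRule R Q O V T)), RuleHolds M N r) ∧
      (∀ r, ∀ ρ ∈ (relRules S r : List (PRule R Q O V T)), RuleHolds M N ρ) ∧
      (∀ r ∈ Sp.hardO, RuleHolds M N (objRule .eqO r)) ∧
      (∀ r ∈ Sp.softO, RuleHolds M N (objRule .activeO r)) ∧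
      (∀ r ∈ Sp.hardV, RuleHolds M N (valRule .eqV r)) ∧
      (∀ r ∈ Sp.softV, RuleHolds M N (valRule .activeV r)) ∧
      (∀ d ∈ Sp.denials, RuleHolds M N (denialRule S d.q)) ∧
      (∀ d ∈ Sp.denials, ∀ ρ ∈ commonRules S d.q, RuleHolds M N ρ) := by
  change F ⊆ N ∧ (∀ r ∈ piSol Sp, RuleHolds M N r) ↔ _
  simp only [piSol, List.forall_mem_append, List.forall_mem_flatMap, List.forall_mem_map,
    Finset.mem_toList, Finset.mem_univ, true_implies, List.forall_mem_cons, forall_and, and_assoc]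

theorem objRule_iff {M N : Set (GAtom R Q O V T)} {p : PPred R Q O V T}
    {r : ObjRule S Q O V T} : RuleHolds M N (objRule p r) ↔
      ∀ σ : PVar → GTerm O V T, AllIn N σ (body S r.q) →
        ⟨p, [(pick r.q r.x).ground σ, (pick r.q r.y).ground σ]⟩ ∈ N := by
  simp [RuleHolds, objRule, Atom.ground]

theorem valRule_iff {M N : Set (GAtom R Q O V T)} {p : PPred R Q O V T}
    {r : ValRule S Q O V T} : RuleHolds M N (valRule p r) ↔
      ∀ σ : PVar → GTerm O V T, AllIn N σ (body S r.q) →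
        ⟨p, [σ (.orig r.x), .inr r.i, σ (.orig r.y), .inr r.j]⟩ ∈ N := by
  simp [RuleHolds, valRule, Atom.ground, ground_var, ground_numT]

theorem denialRule_iff {M N : Set (GAtom R Q O V T)} {q : Query R Q (Const O V T)} :
    RuleHolds M N (denialRule S q) ↔
      ∀ σ : PVar → GTerm O V T, AllIn N σ (relAtoms q ++ joinAtoms S q ++ neqGuard q) →
        ∃ j s, q.neqs[j]? = some s ∧ (commonAtom q j : PAtom R Q O V T).ground σ ∈ M := by
  simp only [RuleHolds, denialRule, List.forall_mem_map, Prod.forall,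
    List.mem_zipIdx_iff_getElem?, reduceCtorEq, false_and, exists_false]
  refine forall_congr' fun σ => ⟨fun H h => ?_, fun H h h' => ?_⟩
  · by_contra hc
    push Not at hc
    exact H (fun u v j h => hc j _ h) h
  · obtain ⟨j, s, hs, hj⟩ := H h'
    exact h s.1 s.2 j hs hj

theorem commonRules_iff {M N : Set (GAtom R Q O V T)} {q : Query R Q (Const O V T)} :
    (∀ ρ ∈ commonRules S q, RuleHolds M N ρ) ↔ ∀ j s, q.neqs[j]? = some s →
      ∀ σ : PVar → GTerm O V T,
        AllIn N σ (relAtoms q ++ memTerm S q (auxT 0) s.1 ++ memTerm S q (auxT 0) s.2) →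
          (commonAtom q j : PAtom R Q O V T).ground σ ∈ N := by
  simp only [commonRules, List.forall_mem_map, List.mem_zipIdx_iff_getElem?, RuleHolds,
    List.not_mem_nil, IsEmpty.forall_iff, implies_true, true_implies, Option.some.injEq,
    exists_eq_left']
  exact ⟨fun H j s h => H (s, j) h, fun H p h => H p.2 p.1 h⟩

end Closure

/-! ### Bodies over the base predicates, and models of the reduct -/

section Stable

variable {R Q O V T : Type*} {S : Schema R} {sim : Q → V → V → Prop} {D : Database S O V T}
  {E : Set (Const O V T × Const O V T)} {W : Set (Cell T × Cell T)}
  {q : Query R Q (Const O V T)}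

theorem memAtom_isBase {o : Occ R (Const O V T)} {c : PTerm O V T} {b : PAtom R Q O V T}
    (hb : b ∈ memAtom S o c) : b.pred.IsBase := by
  unfold memAtom at hb
  split at hb
  · rw [List.mem_singleton.1 hb]; trivial
  · split at hb
    · rw [List.mem_singleton.1 hb]; trivial
    · rw [List.mem_singleton.1 hb]; trivial
    · simp at hb

theorem relAtoms_isBase {b : PAtom R Q O V T} (hb : b ∈ relAtoms q) : b.pred.IsBase := by
  obtain ⟨p, -, rfl⟩ := List.mem_map.1 hb
  trivial

theorem joinAtoms_isBase {b : PAtom R Q O V T} (hb : b ∈ joinAtoms S q) : b.pred.IsBase := by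
  obtain ⟨o, -, hb⟩ := List.mem_flatMap.1 hb
  split at hb
  · simp at hb
  · split at hb
    · exact memAtom_isBase hb
    · simp at hb
  · exact memAtom_isBase hb

theorem simSide_isBase {w : PVar} {u : Term ℕ (Const O V T)} {b : PAtom R Q O V T}
    (hb : b ∈ simSide S q w u) : b.pred.IsBase := by
  cases u with
  | cst c => simp [simSide] at hb
  | var x =>
    obtain ⟨o, -, hb⟩ := List.mem_flatMap.1 hb
    split at hb
    · split at hb
      · rw [List.mem_singleton.1 hb]; trivial
      · simp at hb
    · simp at hb

theorem body_isBase {b : PAtom R Q O V T} (hb : b ∈ body S q) : b.pred.IsBase := by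
  simp only [body, List.mem_append] at hb
  rcases hb with (hb | hb) | hb
  · exact relAtoms_isBase hb
  · exact joinAtoms_isBase hb
  · obtain ⟨s, -, hb⟩ := List.mem_flatMap.1 hb
    simp only [List.mem_append] at hb
    rcases hb with (hb | hb) | hb
    · exact simSide_isBase hb
    · exact simSide_isBase hb
    · rw [List.mem_singleton.1 hb]; trivial

theorem denialBody_isBase {b : PAtom R Q O V T}
    (hb : b ∈ relAtoms q ++ joinAtoms S q ++ neqGuard q) : b.pred.IsBase := by
  simp only [List.mem_append] at hb
  rcases hb with (hb | hb) | hb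
  · exact relAtoms_isBase hb
  · exact joinAtoms_isBase hb
  · obtain ⟨s, -, hb⟩ := List.mem_flatMap.1 hb
    obtain ⟨u, -, hb⟩ := List.mem_flatMap.1 hb
    split at hb
    · rw [List.mem_singleton.1 hb]; trivial
    · simp at hb

theorem memTerm_isBase {t : PTerm O V T} {u : Term ℕ (Const O V T)} {b : PAtom R Q O V T}
    (hb : b ∈ memTerm S q t u) : b.pred.IsBase := by
  cases u with
  | cst a => rw [List.mem_singleton.1 hb]; trivial
  | var x =>
    obtain ⟨o, -, hb⟩ := List.mem_flatMap.1 hb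
    exact memAtom_isBase hb

theorem commonBody_isBase {t : PTerm O V T} {u v : Term ℕ (Const O V T)} {b : PAtom R Q O V T}
    (hb : b ∈ relAtoms q ++ memTerm S q t u ++ memTerm S q t v) : b.pred.IsBase := by
  simp only [List.mem_append] at hb
  rcases hb with (hb | hb) | hb
  · exact relAtoms_isBase hb
  · exact memTerm_isBase hb
  · exact memTerm_isBase hb

theorem AllIn.mono {P X K : Type*} {B B' : Set (Atom P K)} {σ : X → K}
    {l : List (Atom P (Term X K))} (h : AllIn B σ l) (hB : B ⊆ B') : AllIn B' σ l :=
  fun b hb => hB (h b hb)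

theorem AllIn.of_isBase {N B : Set (GAtom R Q O V T)}
    (hN : ∀ a ∈ N, a.pred.IsBase → a ∈ B) {σ : PVar → GTerm O V T} {l : List (PAtom R Q O V T)}
    (hl : ∀ b ∈ l, b.pred.IsBase) (h : AllIn N σ l) : AllIn B σ l :=
  fun b hb => hN _ (h b hb) (hl b hb)

/-- A model that contains the two relations contains everything defined from them. -/
theorem baseAtoms_subset [Fintype R] {Sp : Spec S Q O V T} {M N : Set (GAtom R Q O V T)}
    (hN : IsModelOfReduct (piSol Sp) (inputFacts sim D) M N)
    (hE : ∀ c d, (c, d) ∈ E → (⟨.eqO, [.inl c, .inl d]⟩ : GAtom R Q O V T) ∈ N)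
    (hW : ∀ p p' : Cell T, (p, p') ∈ W →
      (⟨.eqV, [.inl (.tid p.1), .inr p.2, .inl (.tid p'.1), .inr p'.2]⟩ : GAtom R Q O V T) ∈ N) :
    baseAtoms sim D E W ⊆ N := by
  obtain ⟨hF, hgen, hrel, -⟩ := isModelOfReduct_iff.1 hN
  have hgen := genericRules_iff.1 hgen
  have hfact : ∀ f ∈ D.facts, (⟨.tid, [.inl (.tid f.tid)]⟩ : GAtom R Q O V T) ∈ N ∧
      ∀ j s c, (S.ty f.rel)[j]? = some s → f.args[j]? = some c →
        (⟨.proj, [.inl (.tid f.tid), .inr (j + 1), .inl c]⟩ : GAtom R Q O V T) ∈ N ∧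
        (s = .obj → (⟨.obj, [.inl c]⟩ : GAtom R Q O V T) ∈ N) ∧
        (s = .val → (⟨.valpos, [.inl (.tid f.tid), .inr (j + 1)]⟩ : GAtom R Q O V T) ∈ N) := by
    intro f hf
    let σ : PVar → GTerm O V T
      | .occ _ 0 => .inl (.tid f.tid)
      | .occ _ (j + 1) => (f.args[j]?).elim (.inr 0) .inl
      | _ => .inr 0
    have hσ : (freshAtom f.rel (.var (.occ 0 0)) 0 (S.ty f.rel).length :
        PAtom R Q O V T).ground σ ∈ N := by
      have : (freshAtom f.rel (.var (.occ 0 0)) 0 (S.ty f.rel).length :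
          PAtom R Q O V T).ground σ = ⟨.rel f.rel, .inl (.tid f.tid) :: f.args.map .inl⟩ := by
        simp only [freshAtom, Atom.ground, List.map_cons, List.map_map, ground_var, σ,
          Atom.mk.injEq, true_and, List.cons.injEq]
        refine map_range_eq_map_iff.2 ⟨(Database.length_args hf).symm, fun j c hj => ?_⟩
        simp [ground_var, hj]
      rw [this]
      exact hF (.inl ⟨f, hf, rfl⟩)
    obtain ⟨h₁, h₂⟩ := relRules_iff.1 (hrel f.rel) σ hσ
    refine ⟨h₁, fun j s c hs hc => ?_⟩
    have := h₂ j s hs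
    simpa only [σ, hc, Option.elim_some] using this
  have hproj : ∀ p c, D.EntryIs p c →
      (⟨.proj, [.inl (.tid p.1), .inr p.2, .inl c]⟩ : GAtom R Q O V T) ∈ N := by
    rintro ⟨t, i⟩ c ⟨f, hf, ht, j, hj, hc⟩
    obtain ⟨s, hs, -⟩ := Database.exists_ty hf hc
    simp only at ht hj
    subst ht hj
    exact ((hfact f hf).2 j s c hs hc).1
  rintro ⟨p, args⟩ ha
  cases p with
  | rel r =>
    obtain ⟨f, hf, rfl, rfl⟩ := rel_mem_baseAtoms.1 ha
    exact hF (.inl ⟨f, hf, rfl⟩)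
  | sim p =>
    obtain ⟨c, d, hc, hd, h, rfl⟩ := sim_mem_baseAtoms.1 ha
    exact hF (.inr ⟨p, c, d, hc, hd, h, rfl⟩)
  | tid =>
    obtain ⟨f, hf, rfl⟩ := tid_mem_baseAtoms.1 ha
    exact (hfact f hf).1
  | proj =>
    obtain ⟨p, c, h, rfl⟩ := proj_mem_baseAtoms.1 ha
    exact hproj p c h
  | obj =>
    obtain ⟨c, hc, rfl⟩ := obj_mem_baseAtoms.1 ha
    obtain ⟨f, hf, j, hj, hs⟩ := Database.exists_arg_of_mem_objs hc
    exact ((hfact f hf).2 j _ c hs hj).2.1 rfl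
  | valpos =>
    obtain ⟨⟨t, i⟩, ⟨f, hf, ht, j, hi, hs⟩, rfl⟩ := valpos_mem_baseAtoms.1 ha
    simp only at ht hi
    subst ht hi
    obtain ⟨c, hc, -⟩ := Database.exists_arg hf hs
    exact ((hfact f hf).2 j _ c hs hc).2.2 rfl
  | val =>
    obtain ⟨p, p', c, h, hc, rfl⟩ := val_mem_baseAtoms.1 ha
    exact hgen.val _ _ _ _ _ (hW p p' h) (hproj p' c hc)
  | eqO =>
    obtain ⟨c, d, h, rfl⟩ := eqO_mem_baseAtoms.1 ha
    exact hE c d h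
  | eqV =>
    obtain ⟨p, p', h, rfl⟩ := eqV_mem_baseAtoms.1 ha
    exact hW p p' h
  | same =>
    obtain ⟨c, ⟨f, hf, hc⟩, rfl⟩ := same_mem_baseAtoms.1 ha
    rcases hc with rfl | hc
    · exact hgen.same_tid _ (hfact f hf).1
    · obtain ⟨j, hj⟩ := List.mem_iff_getElem?.1 hc
      exact hgen.same_proj _ _ _ (hproj (f.tid, j + 1) c ⟨f, hf, rfl, j, rfl, hj⟩)
  | activeO | activeV | neqO | neqV | common => exact ha.elim

/-- Sufficient conditions for being a model of the reduct, for a set whose atoms over the base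
predicates are those determined by two equivalence relations. -/
theorem isModelOfReduct_of_baseAtoms [Fintype R] {Sp : Spec S Q O V T}
    {M N : Set (GAtom R Q O V T)} (hE : IsEquivOn E D.objs) (hW : IsEquivOn W D.cells)
    (hsub : baseAtoms sim D E W ⊆ N)
    (hbase : ∀ a ∈ N, a.pred.IsBase → a ∈ baseAtoms sim D E W)
    (hEO : ∀ a b, ⟨.neqO, [a, b]⟩ ∉ M → ⟨.activeO, [a, b]⟩ ∈ N → ⟨.eqO, [a, b]⟩ ∈ N)
    (hNO : ∀ a b, ⟨.eqO, [a, b]⟩ ∉ M → ⟨.activeO, [a, b]⟩ ∈ N → ⟨.neqO, [a, b]⟩ ∈ N)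
    (hEV : ∀ a b c d, ⟨.neqV, [a, b, c, d]⟩ ∉ M → ⟨.activeV, [a, b, c, d]⟩ ∈ N →
      ⟨.eqV, [a, b, c, d]⟩ ∈ N)
    (hNV : ∀ a b c d, ⟨.eqV, [a, b, c, d]⟩ ∉ M → ⟨.activeV, [a, b, c, d]⟩ ∈ N →
      ⟨.neqV, [a, b, c, d]⟩ ∈ N)
    (hhardO : ∀ r ∈ Sp.hardO, answers sim D E W r.q r.x r.y ⊆ E)
    (hsoftO : ∀ r ∈ Sp.softO, RuleHolds M N (objRule .activeO r))
    (hhardV : ∀ r ∈ Sp.hardV, ∀ t t' : T, (.tid t, .tid t') ∈ answers sim D E W r.q r.x r.y →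
      ((t, r.i), (t', r.j)) ∈ W)
    (hsoftV : ∀ r ∈ Sp.softV, RuleHolds M N (valRule .activeV r))
    (hden : ∀ d ∈ Sp.denials, RuleHolds M N (denialRule S d.q))
    (hcom : ∀ d ∈ Sp.denials, ∀ ρ ∈ commonRules S d.q, RuleHolds M N ρ) :
    IsModelOfReduct (piSol Sp) (inputFacts sim D) M N := by
  refine isModelOfReduct_iff.2 ⟨?_, genericRules_iff.2 ?_, fun r => relRules_iff.2 ?_, ?_, hsoftO,
    ?_, hsoftV, hden, hcom⟩
  · rintro _ (⟨f, hf, rfl⟩ | ⟨p, c, d, hc, hd, h, rfl⟩)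
    · exact hsub (rel_mem_baseAtoms.2 ⟨f, hf, rfl, rfl⟩)
    · exact hsub (sim_mem_baseAtoms.2 ⟨c, d, hc, hd, h, rfl⟩)
  · constructor
    · intro a b c d e h h'
      obtain ⟨⟨t, i⟩, ⟨t', i'⟩, hp, he⟩ := eqV_mem_baseAtoms.1 (hbase _ h trivial)
      obtain ⟨⟨t₁, i₁⟩, c', hc, he'⟩ := proj_mem_baseAtoms.1 (hbase _ h' trivial)
      simp only [List.cons.injEq, and_true] at he he'
      obtain ⟨rfl, rfl, rfl, rfl⟩ := he
      obtain ⟨h₁, h₂, rfl⟩ := he'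
      cases h₁
      cases h₂
      exact hsub (val_mem_baseAtoms.2 ⟨_, _, _, hp, hc, rfl⟩)
    · intro a h
      obtain ⟨f, hf, he⟩ := tid_mem_baseAtoms.1 (hbase _ h trivial)
      cases he
      exact hsub (same_mem_baseAtoms.2 ⟨_, Database.tid_mem_dom hf, rfl⟩)
    · intro a b c h
      obtain ⟨p, c', hc, he⟩ := proj_mem_baseAtoms.1 (hbase _ h trivial)
      cases he
      exact hsub (same_mem_baseAtoms.2 ⟨_, hc.mem_dom, rfl⟩)
    · intro a h
      obtain ⟨c, hc, he⟩ := obj_mem_baseAtoms.1 (hbase _ h trivial)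
      cases he
      exact hsub (eqO_mem_baseAtoms.2 ⟨_, _, hE.refl hc, rfl⟩)
    · intro a b h
      obtain ⟨c, d, hc, he⟩ := eqO_mem_baseAtoms.1 (hbase _ h trivial)
      cases he
      exact hsub (eqO_mem_baseAtoms.2 ⟨_, _, hE.symm hc, rfl⟩)
    · intro a b c h h'
      obtain ⟨c₁, d₁, h₁, he⟩ := eqO_mem_baseAtoms.1 (hbase _ h trivial)
      obtain ⟨c₂, d₂, h₂, he'⟩ := eqO_mem_baseAtoms.1 (hbase _ h' trivial)
      cases he
      cases he'
      exact hsub (eqO_mem_baseAtoms.2 ⟨_, _, hE.trans h₁ h₂, rfl⟩)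
    · intro a b _ h
      obtain ⟨p, hp, he⟩ := valpos_mem_baseAtoms.1 (hbase _ h trivial)
      cases he
      exact hsub (eqV_mem_baseAtoms.2 ⟨_, _, hW.refl hp, rfl⟩)
    · intro a b c d h
      obtain ⟨p, p', hp, he⟩ := eqV_mem_baseAtoms.1 (hbase _ h trivial)
      cases he
      exact hsub (eqV_mem_baseAtoms.2 ⟨_, _, hW.symm hp, rfl⟩)
    · intro a b c d e f h h'
      obtain ⟨p, ⟨t, i⟩, hp, he⟩ := eqV_mem_baseAtoms.1 (hbase _ h trivial)
      obtain ⟨⟨t', i'⟩, p', hp', he'⟩ := eqV_mem_baseAtoms.1 (hbase _ h' trivial)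
      cases he
      cases he'
      exact hsub (eqV_mem_baseAtoms.2 ⟨_, _, hW.trans hp hp', rfl⟩)
    · exact hEO
    · exact hNO
    · exact hEV
    · exact hNV
  · intro σ h
    obtain ⟨f, hf, hr, he⟩ := rel_mem_baseAtoms.1 (hbase _ h trivial)
    simp only [freshAtom, List.map_cons, List.map_map, ground_var, List.cons.injEq] at he
    obtain ⟨h₀, he⟩ := he
    obtain ⟨-, harg⟩ := map_range_eq_map_iff.1 he
    subst hr
    rw [h₀]
    refine ⟨hsub (tid_mem_baseAtoms.2 ⟨f, hf, rfl⟩), fun j s hs => ?_⟩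
    obtain ⟨c, hc, hcs⟩ := Database.exists_arg hf hs
    have hj : σ (.occ 0 (j + 1)) = .inl c := harg j c hc
    rw [hj]
    refine ⟨hsub (proj_mem_baseAtoms.2 ⟨(f.tid, j + 1), c, ⟨f, hf, rfl, j, rfl, hc⟩, rfl⟩), ?_, ?_⟩
    · rintro rfl
      cases c with
      | obj o => exact hsub (obj_mem_baseAtoms.2 ⟨_, Database.mem_objs_of_arg hf hc, rfl⟩)
      | val _ => exact hcs.elim
      | tid _ => exact hcs.elim
    · rintro rfl
      exact hsub (valpos_mem_baseAtoms.2 ⟨(f.tid, j + 1), ⟨f, hf, rfl, j, rfl, hs⟩, rfl⟩)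
  · refine fun r hr => objRule_iff.2 fun σ h => ?_
    obtain ⟨c, d, c', d', ha, hc, hd, hcE, hdE⟩ :=
      r.answer_of_body hE hW (h.of_isBase hbase fun _ => body_isBase)
    rw [hc, hd]
    exact hsub (eqO_mem_baseAtoms.2
      ⟨_, _, hE.trans (hE.trans hcE (hhardO r hr ha)) (hE.symm hdE), rfl⟩)
  · refine fun r hr => valRule_iff.2 fun σ h => ?_
    obtain ⟨t, t', ha, ht, ht', -⟩ :=
      r.answer_of_body hE hW (h.of_isBase hbase fun _ => body_isBase)
    rw [ht, ht']
    exact hsub (eqV_mem_baseAtoms.2 ⟨_, _, hhardV r hr t t' ha, rfl⟩)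

end Stable

/-! ### From solutions to stable models -/

section Solution

variable {R Q O V T : Type*} {S : Schema R} {sim : Q → V → V → Prop} {D : Database S O V T}
  {E : Set (Const O V T × Const O V T)} {W : Set (Cell T × Cell T)}

/-- The relation on constants that is read off from a set of ground atoms. -/
def relO (N : Set (GAtom R Q O V T)) : Set (Const O V T × Const O V T) :=
  {p | (⟨.eqO, [.inl p.1, .inl p.2]⟩ : GAtom R Q O V T) ∈ N}

/-- The relation on cells that is read off from a set of ground atoms. -/
def relV (N : Set (GAtom R Q O V T)) : Set (Cell T × Cell T) :=
  {p | (⟨.eqV, [.inl (.tid p.1.1), .inr p.1.2, .inl (.tid p.2.1), .inr p.2.2]⟩ :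
    GAtom R Q O V T) ∈ N}

section Model

variable [Fintype R] {Sp : Spec S Q O V T} {M N : Set (GAtom R Q O V T)}

theorem eqRel_subset_relO (hN : IsModelOfReduct (piSol Sp) (inputFacts sim D) M N)
    {P : Set (Const O V T × Const O V T)} (hP : P ⊆ relO N) : eqRel P D.objs ⊆ relO N := by
  have hgen := genericRules_iff.1 (isModelOfReduct_iff.1 hN).2.1
  have hsub := baseAtoms_subset (E := ∅) (W := ∅) hN (by simp) (by simp)
  exact eqRel_subset hP
    (fun c hc => hgen.reflO _ (hsub (obj_mem_baseAtoms.2 ⟨c, hc, rfl⟩)))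
    (fun _ _ h => hgen.symmO _ _ h) (fun _ _ _ h h' => hgen.transO _ _ _ h h')

theorem eqRel_subset_relV (hN : IsModelOfReduct (piSol Sp) (inputFacts sim D) M N)
    {P : Set (Cell T × Cell T)} (hP : P ⊆ relV N) : eqRel P D.cells ⊆ relV N := by
  have hgen := genericRules_iff.1 (isModelOfReduct_iff.1 hN).2.1
  have hsub := baseAtoms_subset (E := ∅) (W := ∅) hN (by simp) (by simp)
  refine eqRel_subset hP (fun p hp => ?_) (fun _ _ h => hgen.symmV _ _ _ _ h)
    (fun _ _ _ h h' => hgen.transV _ _ _ _ _ _ h h')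
  obtain ⟨f, hf, ht, -⟩ := id hp
  refine hgen.reflV _ _ ?_ (hsub (valpos_mem_baseAtoms.2 ⟨p, hp, rfl⟩))
  rw [ht]
  exact hsub (tid_mem_baseAtoms.2 ⟨f, hf, rfl⟩)

theorem baseAtoms_subset_of_le (hN : IsModelOfReduct (piSol Sp) (inputFacts sim D) M N)
    (hE : E ⊆ relO N) (hW : W ⊆ relV N) : baseAtoms sim D E W ⊆ N :=
  baseAtoms_subset hN (fun _ _ h => hE h) fun _ _ h => hW h

end Model

theorem relO_eq {N : Set (GAtom R Q O V T)} (hsub : baseAtoms sim D E W ⊆ N)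
    (hbase : ∀ a ∈ N, a.pred.IsBase → a ∈ baseAtoms sim D E W) : relO N = E := by
  ext ⟨c, d⟩
  refine ⟨fun h => ?_, fun h => hsub (eqO_mem_baseAtoms.2 ⟨c, d, h, rfl⟩)⟩
  obtain ⟨c', d', h, he⟩ := eqO_mem_baseAtoms.1 (hbase _ h trivial)
  cases he
  exact h

theorem relV_eq {N : Set (GAtom R Q O V T)} (hsub : baseAtoms sim D E W ⊆ N)
    (hbase : ∀ a ∈ N, a.pred.IsBase → a ∈ baseAtoms sim D E W) : relV N = W := by
  ext ⟨p, p'⟩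
  refine ⟨fun h => ?_, fun h => hsub (eqV_mem_baseAtoms.2 ⟨p, p', h, rfl⟩)⟩
  obtain ⟨⟨t, i⟩, ⟨t', i'⟩, h, he⟩ := eqV_mem_baseAtoms.1 (hbase _ h trivial)
  simp only [List.cons.injEq, and_true, Sum.inl.injEq, Sum.inr.injEq, Const.tid.injEq] at he
  obtain ⟨h₁, h₂, h₃, h₄⟩ := he
  rwa [show p = (t, i) from Prod.ext h₁ h₂, show p' = (t', i') from Prod.ext h₃ h₄]

/-- The heads of the instances of the translated soft rules whose bodies are contained in `B`. -/
def softAtoms (Sp : Spec S Q O V T) (B : Set (GAtom R Q O V T)) : Set (GAtom R Q O V T) :=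
  {a | (∃ r ∈ Sp.softO, ∃ σ : PVar → GTerm O V T, AllIn B σ (body S r.q) ∧
      a = ⟨.activeO, [(pick r.q r.x).ground σ, (pick r.q r.y).ground σ]⟩) ∨
    ∃ r ∈ Sp.softV, ∃ σ : PVar → GTerm O V T, AllIn B σ (body S r.q) ∧
      a = ⟨.activeV, [σ (.orig r.x), .inr r.i, σ (.orig r.y), .inr r.j]⟩}

/-- The heads of the instances of the rules `commonRules S q` whose bodies are contained in `B`. -/
def commonAtoms (S : Schema R) (B : Set (GAtom R Q O V T)) (q : Query R Q (Const O V T)) :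
    Set (GAtom R Q O V T) :=
  {a | ∃ j s, q.neqs[j]? = some s ∧ ∃ σ : PVar → GTerm O V T,
    AllIn B σ (relAtoms q ++ memTerm S q (auxT 0) s.1 ++ memTerm S q (auxT 0) s.2) ∧
    a = (commonAtom q j : PAtom R Q O V T).ground σ}

/-- The stable model of a solution. -/
def solModel (sim : Q → V → V → Prop) (D : Database S O V T) (Sp : Spec S Q O V T)
    (E : Set (Const O V T × Const O V T)) (W : Set (Cell T × Cell T)) : Set (GAtom R Q O V T) :=
  {a | match a.pred with
    | .activeO | .activeV => a ∈ softAtoms Sp (baseAtoms sim D E W)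
    | .neqO => (⟨.activeO, a.args⟩ : GAtom R Q O V T) ∈ softAtoms Sp (baseAtoms sim D E W) ∧
        (⟨.eqO, a.args⟩ : GAtom R Q O V T) ∉ baseAtoms sim D E W
    | .neqV => (⟨.activeV, a.args⟩ : GAtom R Q O V T) ∈ softAtoms Sp (baseAtoms sim D E W) ∧
        (⟨.eqV, a.args⟩ : GAtom R Q O V T) ∉ baseAtoms sim D E W
    | .common q _ => (∃ d ∈ Sp.denials, d.q = q) ∧ a ∈ commonAtoms S (baseAtoms sim D E W) q
    | _ => a ∈ baseAtoms sim D E W}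

theorem mem_baseAtoms_of_mem_solModel {Sp : Spec S Q O V T} {a : GAtom R Q O V T}
    (h : a ∈ solModel sim D Sp E W) (ha : a.pred.IsBase) : a ∈ baseAtoms sim D E W := by
  obtain ⟨p, l⟩ := a
  cases p <;> first | exact h | exact ha.elim

theorem baseAtoms_subset_solModel {Sp : Spec S Q O V T} :
    baseAtoms sim D E W ⊆ (solModel sim D Sp E W : Set (GAtom R Q O V T)) := by
  rintro ⟨p, l⟩ h
  have hb := isBase_of_mem_baseAtoms h
  cases p <;> first | exact h | exact hb.elim

/-- A denial constraint is violated exactly if the positive part of its translation holds for some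
substitution and none of the negated atoms is derivable. -/
theorem Denial.sat_iff_commonAtoms (d : Denial S Q O V T) (hE : IsEquivOn E D.objs)
    (hW : IsEquivOn W D.cells) :
    Sat sim D E W d.q ↔ ∃ σ : PVar → GTerm O V T,
      AllIn (baseAtoms sim D E W) σ (relAtoms d.q ++ joinAtoms S d.q ++ neqGuard d.q) ∧
      ∀ j s, d.q.neqs[j]? = some s →
        (commonAtom d.q j : PAtom R Q O V T).ground σ ∉
          commonAtoms S (baseAtoms sim D E W) d.q := by
  rw [d.sat_iff hE hW]
  refine exists_congr fun σ => and_congr_right fun _ => forall₃_congr fun j s hs => ?_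
  refine not_congr ⟨?_, ?_⟩
  · rintro ⟨σ', h, hσ'⟩
    exact ⟨j, s, hs, σ', hσ', h.symm⟩
  · rintro ⟨j', s', hs', σ', hσ', h⟩
    obtain rfl : j = j' := by
      have := congrArg Atom.pred h
      simp only [Atom.ground, commonAtom, Pred.common.injEq, true_and] at this
      exact this
    rw [hs] at hs'
    cases hs'
    exact ⟨σ', h.symm, hσ'⟩

variable [Fintype R] {Sp : Spec S Q O V T}

theorem IsSolution.isModelOfReduct (h : IsSolution sim D Sp E W) :
    IsModelOfReduct (piSol Sp) (inputFacts sim D) (solModel sim D Sp E W)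
      (solModel sim D Sp E W : Set (GAtom R Q O V T)) := by
  obtain ⟨hE, hW⟩ := h.candidate.isEquivOn
  have hbase : ∀ a ∈ (solModel sim D Sp E W : Set (GAtom R Q O V T)), a.pred.IsBase →
      a ∈ baseAtoms sim D E W := fun a => mem_baseAtoms_of_mem_solModel
  refine isModelOfReduct_of_baseAtoms hE hW baseAtoms_subset_solModel hbase ?_ ?_ ?_ ?_
    h.hardO (fun r hr => objRule_iff.2 fun σ hσ => ?_)
    h.hardV (fun r hr => valRule_iff.2 fun σ hσ => ?_)
    (fun d hd => denialRule_iff.2 fun σ hσ => ?_)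
    (fun d hd => commonRules_iff.2 fun j s hs σ hσ => ?_)
  · intro a b hn ha
    by_contra he
    exact hn ⟨ha, he⟩
  · exact fun a b he ha => ⟨ha, he⟩
  · intro a b c d hn ha
    by_contra he
    exact hn ⟨ha, he⟩
  · exact fun a b c d he ha => ⟨ha, he⟩
  · exact .inl ⟨r, hr, σ, hσ.of_isBase hbase fun _ => body_isBase, rfl⟩
  · exact .inr ⟨r, hr, σ, hσ.of_isBase hbase fun _ => body_isBase, rfl⟩
  · by_contra hc
    refine h.denials d hd ((d.sat_iff_commonAtoms hE hW).2
      ⟨σ, hσ.of_isBase hbase fun _ => denialBody_isBase, fun j s hs hj => ?_⟩)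
    exact hc ⟨j, s, hs, ⟨d, hd, rfl⟩, hj⟩
  · exact ⟨⟨d, hd, rfl⟩, j, s, hs, σ, hσ.of_isBase hbase fun _ => commonBody_isBase, rfl⟩

/-- All merges of a derivation of a candidate solution are forced in a model of the reduct: if a
soft rule is applied and its conclusion belongs to the solution, then the reduct contains the
corresponding instance of the choice rule. -/
theorem IsCandidate.subset_of_isModelOfReduct {N : Set (GAtom R Q O V T)} (hE : IsEquivOn E D.objs)
    (hN : IsModelOfReduct (piSol Sp) (inputFacts sim D) (solModel sim D Sp E W) N)
    {E' : Set (Const O V T × Const O V T)} {W' : Set (Cell T × Cell T)}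
    (h : IsCandidate sim D Sp E' W') (hE' : E' ⊆ E) (hW' : W' ⊆ W) :
    E' ⊆ relO N ∧ W' ⊆ relV N := by
  obtain ⟨-, hgen, -, hhO, hsO, hhV, hsV, -⟩ := isModelOfReduct_iff.1 hN
  have hgen := genericRules_iff.1 hgen
  induction h with
  | init =>
    exact ⟨eqRel_subset_relO hN (Set.empty_subset _), eqRel_subset_relV hN (Set.empty_subset _)⟩
  | @mergeO E₁ W₁ r o o' hc hr ha ih =>
    have hle := Set.subset_union_left.trans (subset_eqRel.trans hE')
    obtain ⟨ihE, ihW⟩ := ih hle hW'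
    refine ⟨eqRel_subset_relO hN (Set.union_subset ihE ?_), ihW⟩
    rintro _ rfl
    obtain ⟨σ, c, d, hb, hx, hy, hco, hdo⟩ := r.body_of_answer hc.isEquivOn.1 ha
    have hb := hb.mono (baseAtoms_subset_of_le hN ihE ihW)
    have hcd : (⟨.eqO, [.inl c, .inl d]⟩ : GAtom R Q O V T) ∈ N := by
      rcases hr with hr | hr
      · have := objRule_iff.1 (hhO r hr) σ hb
        rwa [hx, hy] at this
      · have := objRule_iff.1 (hsO r hr) σ hb
        rw [hx, hy] at this
        refine hgen.eqO _ _ (fun hn => hn.2 (eqO_mem_baseAtoms.2 ⟨c, d, ?_, rfl⟩)) this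
        have hoo : (o, o') ∈ E := hE' (.base (.inr rfl))
        exact hE.trans (hE.trans (hle hco) hoo) (hE.symm (hle hdo))
    exact hgen.transO _ _ _ (hgen.symmO _ _ (ihE hco)) (hgen.transO _ _ _ hcd (ihE hdo))
  | @mergeV E₁ W₁ r t t' hc hr ha ih =>
    have hle := Set.subset_union_left.trans (subset_eqRel.trans hW')
    obtain ⟨ihE, ihW⟩ := ih hE' hle
    refine ⟨ihE, eqRel_subset_relV hN (Set.union_subset ihW ?_)⟩
    rintro _ rfl
    obtain ⟨σ, hb, hx, hy, -⟩ := r.body_of_answer hc.isEquivOn.1 ha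
    have hb := hb.mono (baseAtoms_subset_of_le hN ihE ihW)
    rcases hr with hr | hr
    · have := valRule_iff.1 (hhV r hr) σ hb
      rwa [hx, hy] at this
    · have := valRule_iff.1 (hsV r hr) σ hb
      rw [hx, hy] at this
      refine hgen.eqV _ _ _ _ (fun hn => hn.2 (eqV_mem_baseAtoms.2 ⟨_, _, ?_, rfl⟩)) this
      exact hW' (.base (.inr rfl))

theorem IsSolution.isStableModel (h : IsSolution sim D Sp E W) :
    IsStableModel (piSol Sp) (inputFacts sim D)
      (solModel sim D Sp E W : Set (GAtom R Q O V T)) := by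
  refine ⟨h.isModelOfReduct, fun N hNM hN => hNM.antisymm ?_⟩
  obtain ⟨hEN, hWN⟩ := h.candidate.subset_of_isModelOfReduct h.candidate.isEquivOn.1 hN
    subset_rfl subset_rfl
  have hsub := baseAtoms_subset_of_le hN hEN hWN
  obtain ⟨-, hgen, -, -, hsO, -, hsV, -, hcom⟩ := isModelOfReduct_iff.1 hN
  have hgen := genericRules_iff.1 hgen
  have hsoft : softAtoms Sp (baseAtoms sim D E W) ⊆ N := by
    rintro _ (⟨r, hr, σ, hσ, rfl⟩ | ⟨r, hr, σ, hσ, rfl⟩)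
    · exact objRule_iff.1 (hsO r hr) σ (hσ.mono hsub)
    · exact valRule_iff.1 (hsV r hr) σ (hσ.mono hsub)
  rintro ⟨p, l⟩ ha
  cases p with
  | activeO => exact hsoft ha
  | activeV => exact hsoft ha
  | neqO =>
    obtain ⟨ha, he⟩ := ha
    have ha' := hsoft ha
    rcases ha with ⟨r, -, σ, -, hl⟩ | ⟨r, -, σ, -, hl⟩
    · cases hl
      exact hgen.neqO _ _ he ha'
    · cases hl
  | neqV =>
    obtain ⟨ha, he⟩ := ha
    have ha' := hsoft ha
    rcases ha with ⟨r, -, σ, -, hl⟩ | ⟨r, -, σ, -, hl⟩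
    · cases hl
    · cases hl
      exact hgen.neqV _ _ _ _ he ha'
  | common q j =>
    obtain ⟨⟨d, hd, rfl⟩, j', s, hs, σ, hσ, he⟩ := ha
    rw [he]
    exact commonRules_iff.1 (hcom d hd) j' s hs σ (hσ.mono hsub)
  | _ => exact hsub ha

end Solution

/-! ### From stable models to solutions -/

section StableModel

variable {R Q O V T : Type*} {S : Schema R} {sim : Q → V → V → Prop} {D : Database S O V T}
  {E : Set (Const O V T × Const O V T)} {W : Set (Cell T × Cell T)}

theorem exists_maximal_candidate {Sp : Spec S Q O V T}
    (hE : eqRel ∅ D.objs ⊆ E) (hW : eqRel ∅ D.cells ⊆ W) :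
    ∃ E' W', IsCandidate sim D Sp E' W' ∧ E' ⊆ E ∧ W' ⊆ W ∧
      ∀ E₁ W₁, IsCandidate sim D Sp E₁ W₁ → E₁ ⊆ E → W₁ ⊆ W → E' ⊆ E₁ → W' ⊆ W₁ →
        E₁ ⊆ E' ∧ W₁ ⊆ W' := by
  let C : Set (Set (Const O V T × Const O V T) × Set (Cell T × Cell T)) :=
    {p | IsCandidate sim D Sp p.1 p.2 ∧ p.1 ⊆ E ∧ p.2 ⊆ W}
  have hfin : C.Finite := by
    have hO := (Database.finite_objs (D := D)).prod (Database.finite_objs (D := D))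
    have hV := (Database.finite_cells (D := D)).prod (Database.finite_cells (D := D))
    refine (hO.powerset.prod hV.powerset).subset ?_
    rintro ⟨E', W'⟩ ⟨h, -⟩
    exact ⟨h.isEquivOn.1.subset_prod, h.isEquivOn.2.subset_prod⟩
  obtain ⟨⟨E', W'⟩, ⟨hc, hE', hW'⟩, hmax⟩ :=
    hfin.exists_maximal ⟨(eqRel ∅ D.objs, eqRel ∅ D.cells), .init, hE, hW⟩
  refine ⟨E', W', hc, hE', hW', fun E₁ W₁ h₁ hE₁ hW₁ hle hle' => ?_⟩
  have := hmax (y := (E₁, W₁)) ⟨h₁, hE₁, hW₁⟩ ⟨hle, hle'⟩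
  exact ⟨this.1, this.2⟩

variable {M : Set (GAtom R Q O V T)}

/-- The part of `M` that is supported by the relations `E` and `W`. The active atoms are kept unless
they would force a merge which `M` contains but which is missing from `E` or `W`. -/
def supportedPart (sim : Q → V → V → Prop) (D : Database S O V T)
    (E : Set (Const O V T × Const O V T)) (W : Set (Cell T × Cell T))
    (M : Set (GAtom R Q O V T)) : Set (GAtom R Q O V T) :=
  {a | a ∈ M ∧ match a.pred with
    | .activeO => (⟨.eqO, a.args⟩ : GAtom R Q O V T) ∈ M →
        (⟨.eqO, a.args⟩ : GAtom R Q O V T) ∈ baseAtoms sim D E W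
    | .activeV => (⟨.eqV, a.args⟩ : GAtom R Q O V T) ∈ M →
        (⟨.eqV, a.args⟩ : GAtom R Q O V T) ∈ baseAtoms sim D E W
    | .neqO | .neqV => True
    | .common q _ => a ∈ commonAtoms S M q
    | _ => a ∈ baseAtoms sim D E W}

theorem mem_baseAtoms_of_mem_supportedPart {a : GAtom R Q O V T}
    (h : a ∈ supportedPart sim D E W M) (ha : a.pred.IsBase) : a ∈ baseAtoms sim D E W := by
  obtain ⟨p, l⟩ := a
  cases p <;> first | exact h.2 | exact ha.elim

theorem baseAtoms_subset_supportedPart (hM : baseAtoms sim D E W ⊆ M) :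
    baseAtoms sim D E W ⊆ supportedPart sim D E W M := by
  rintro ⟨p, l⟩ h
  have hb := isBase_of_mem_baseAtoms h
  refine ⟨hM h, ?_⟩
  cases p <;> first | exact h | exact hb.elim

variable [Fintype R] {Sp : Spec S Q O V T}

/-- A stable model coincides with the part of it that is supported by a maximal candidate solution
below the relations read off from it, because that part is a model of the reduct. -/
theorem IsStableModel.exists_candidate
    (hM : IsStableModel (piSol Sp) (inputFacts sim D) M) :
    IsCandidate sim D Sp (relO M) (relV M) ∧
      supportedPart sim D (relO M) (relV M) M = M := by
  obtain ⟨hmod, hmin⟩ := hM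
  obtain ⟨-, hgen, -, hhO, hsO, hhV, hsV, hden, hcom⟩ := isModelOfReduct_iff.1 hmod
  have hgen := genericRules_iff.1 hgen
  obtain ⟨E', W', hc, hE', hW', hmax⟩ := exists_maximal_candidate (sim := sim) (Sp := Sp)
    (eqRel_subset_relO hmod (Set.empty_subset _)) (eqRel_subset_relV hmod (Set.empty_subset _))
  obtain ⟨hE, hW⟩ := hc.isEquivOn
  have hsub : baseAtoms sim D E' W' ⊆ M := baseAtoms_subset_of_le hmod hE' hW'
  -- by maximality, an applicable merge that is contained in `M` has been performed
  have hmergeO : ∀ r : ObjRule S Q O V T, r ∈ Sp.hardO ∨ r ∈ Sp.softO → ∀ p,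
      p ∈ answers sim D E' W' r.q r.x r.y → p ∈ relO M → p ∈ E' := by
    rintro r hr ⟨c, d⟩ ha hp
    refine (hmax _ W' (.mergeO r c d hc hr ha) (eqRel_subset_relO hmod ?_) hW'
      (Set.subset_union_left.trans subset_eqRel) subset_rfl).1 (.base (.inr rfl))
    exact Set.union_subset hE' (Set.singleton_subset_iff.2 hp)
  have hmergeV : ∀ r : ValRule S Q O V T, r ∈ Sp.hardV ∨ r ∈ Sp.softV → ∀ t t' : T,
      (.tid t, .tid t') ∈ answers sim D E' W' r.q r.x r.y →
      ((t, r.i), (t', r.j)) ∈ relV M → ((t, r.i), (t', r.j)) ∈ W' := by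
    rintro r hr t t' ha hp
    refine (hmax E' _ (.mergeV r t t' hc hr ha) hE' (eqRel_subset_relV hmod ?_)
      subset_rfl (Set.subset_union_left.trans subset_eqRel)).2 (.base (.inr rfl))
    exact Set.union_subset hW' (Set.singleton_subset_iff.2 hp)
  have hbase : ∀ a ∈ supportedPart sim D E' W' M, a.pred.IsBase → a ∈ baseAtoms sim D E' W' :=
    fun a => mem_baseAtoms_of_mem_supportedPart
  have hsubN := baseAtoms_subset_supportedPart hsub
  have hle : supportedPart sim D E' W' M ⊆ M := fun a h => h.1
  have hN : supportedPart sim D E' W' M = M := by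
    refine hmin _ hle (isModelOfReduct_of_baseAtoms hE hW hsubN hbase ?_ ?_ ?_ ?_
      (fun r hr p hp => hmergeO r (.inl hr) p hp ?_)
      (fun r hr => objRule_iff.2 fun σ hσ => ?_)
      (fun r hr t t' ha => hmergeV r (.inl hr) t t' ha ?_)
      (fun r hr => valRule_iff.2 fun σ hσ => ?_)
      (fun d hd => denialRule_iff.2 fun σ hσ => denialRule_iff.1 (hden d hd) σ (hσ.mono hle))
      (fun d hd => commonRules_iff.2 fun j s hs σ hσ => ?_))
    · exact fun a b hn ha =>
        ⟨hgen.eqO a b hn ha.1, ha.2 (hgen.eqO a b hn ha.1)⟩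
    · exact fun a b he ha => ⟨hgen.neqO a b he ha.1, trivial⟩
    · exact fun a b c d hn ha =>
        ⟨hgen.eqV a b c d hn ha.1, ha.2 (hgen.eqV a b c d hn ha.1)⟩
    · exact fun a b c d he ha => ⟨hgen.neqV a b c d he ha.1, trivial⟩
    · obtain ⟨σ, c', d', hb, hx, hy, hcE, hdE⟩ := r.body_of_answer hE (c := p.1) (d := p.2) hp
      have h := objRule_iff.1 (hhO r hr) σ (hb.mono hsub)
      rw [hx, hy] at h
      exact hgen.transO _ _ _ (hgen.symmO _ _ (hE' hcE)) (hgen.transO _ _ _ h (hE' hdE))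
    · refine ⟨objRule_iff.1 (hsO r hr) σ (hσ.mono hle), fun he => ?_⟩
      obtain ⟨c, d, c', d', ha, hx, hy, hcE, hdE⟩ :=
        r.answer_of_body hE hW (hσ.of_isBase hbase fun _ => body_isBase)
      simp only [hx, hy] at he ⊢
      have hcd : (c, d) ∈ relO M :=
        hgen.transO _ _ _ (hgen.symmO _ _ (hE' hcE)) (hgen.transO _ _ _ he (hE' hdE))
      exact eqO_mem_baseAtoms.2 ⟨c', d',
        hE.trans (hE.trans hcE (hmergeO r (.inr hr) _ ha hcd)) (hE.symm hdE), rfl⟩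
    · obtain ⟨σ, hb, hx, hy, -⟩ := r.body_of_answer hE ha
      have h := valRule_iff.1 (hhV r hr) σ (hb.mono hsub)
      rwa [hx, hy] at h
    · refine ⟨valRule_iff.1 (hsV r hr) σ (hσ.mono hle), fun he => ?_⟩
      obtain ⟨t, t', ha, hx, hy, -⟩ :=
        r.answer_of_body hE hW (hσ.of_isBase hbase fun _ => body_isBase)
      simp only [hx, hy] at he ⊢
      exact eqV_mem_baseAtoms.2 ⟨_, _, hmergeV r (.inr hr) t t' ha he, rfl⟩
    · exact ⟨commonRules_iff.1 (hcom d hd) j s hs σ (hσ.mono hle), j, s, hs, σ, hσ.mono hle, rfl⟩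
  obtain rfl : relO M = E' := by rw [← hN]; exact relO_eq hsubN hbase
  obtain rfl : relV M = W' := by rw [← hN]; exact relV_eq hsubN hbase
  exact ⟨hc, hN⟩

theorem IsStableModel.isSolution (hM : IsStableModel (piSol Sp) (inputFacts sim D) M) :
    IsSolution sim D Sp (relO M) (relV M) := by
  obtain ⟨hc, hsupp⟩ := hM.exists_candidate
  obtain ⟨hE, hW⟩ := hc.isEquivOn
  have hmod := hM.1
  have hsub : baseAtoms sim D (relO M) (relV M) ⊆ M :=
    baseAtoms_subset_of_le hmod subset_rfl subset_rfl
  have hbase : ∀ a ∈ M, a.pred.IsBase → a ∈ baseAtoms sim D (relO M) (relV M) := by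
    intro a ha
    rw [← hsupp] at ha
    exact mem_baseAtoms_of_mem_supportedPart ha
  obtain ⟨-, -, -, hhO, -, hhV, -, hden, -⟩ := isModelOfReduct_iff.1 hmod
  refine ⟨hc, ?_, ?_, ?_⟩
  · rintro r hr ⟨c, d⟩ ha
    obtain ⟨σ, c', d', hb, hx, hy, hcE, hdE⟩ := r.body_of_answer hE ha
    have h := objRule_iff.1 (hhO r hr) σ (hb.mono hsub)
    rw [hx, hy] at h
    exact hE.trans (hE.symm hcE) (hE.trans h hdE)
  · intro r hr t t' ha
    obtain ⟨σ, hb, hx, hy, -⟩ := r.body_of_answer hE ha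
    have h := valRule_iff.1 (hhV r hr) σ (hb.mono hsub)
    rwa [hx, hy] at h
  · intro d hd hsat
    obtain ⟨σ, hσ, hne⟩ := (d.sat_iff_commonAtoms hE hW).1 hsat
    obtain ⟨j, s, hs, hj⟩ := denialRule_iff.1 (hden d hd) σ (hσ.mono hsub)
    rw [← hsupp] at hj
    obtain ⟨j', s', hs', σ', hσ', he⟩ := hj.2
    exact hne j s hs ⟨j', s', hs', σ', hσ'.of_isBase hbase fun _ => commonBody_isBase, he⟩

end StableModel

end Lace

theorem theorem3 {R Q O V T : Type*} [Fintype R] (S : Lace.Schema R)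
    (sim : Q → V → V → Prop) (Sp : Lace.Spec S Q O V T) (D : Lace.Database S O V T)
    (E : Set (Lace.Const O V T × Lace.Const O V T)) (W : Set (Lace.Cell T × Lace.Cell T)) :
    Lace.IsSolution sim D Sp E W ↔
      ∃ M : Set (Lace.GAtom R Q O V T),
        Lace.IsStableModel (Lace.piSol Sp) (Lace.inputFacts sim D) M ∧
        E = {p | (⟨.eqO, [.inl p.1, .inl p.2]⟩ : Lace.GAtom R Q O V T) ∈ M} ∧
        W = {p | (⟨.eqV, [.inl (.tid p.1.1), .inr p.1.2, .inl (.tid p.2.1), .inr p.2.2]⟩ :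
          Lace.GAtom R Q O V T) ∈ M} := by
  constructor
  · intro h
    have hsub := Lace.baseAtoms_subset_solModel (sim := sim) (D := D) (E := E) (W := W) (Sp := Sp)
    have hbase := fun (a : Lace.GAtom R Q O V T) (ha : a ∈ Lace.solModel sim D Sp E W) =>
      Lace.mem_baseAtoms_of_mem_solModel ha
    exact ⟨Lace.solModel sim D Sp E W, h.isStableModel, (Lace.relO_eq hsub hbase).symm,
      (Lace.relV_eq hsub hbase).symm⟩
  · rintro ⟨M, hM, rfl, rfl⟩
    exact hM.isSolution
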